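/- Let $\mathcal H$ and $\mathcal G$ be real Hilbert spaces, and let $\Gamma_0(\cdot)$ denote the class of proper lower semicontinuous convex functions with values in $]-\infty,+\infty]$. For $f\colon\mathcal H\to[-\infty,+\infty]$, $f^*$ is its conjugate, $\operatorname{dom}f=\{f<+\infty\}$, and $\overline{\operatorname{dom}}f$ is the closure of $\operatorname{dom} f$. For $f\in\Gamma_0(\mathcal H)$, $\operatorname{prox}_f x$ is the unique minimizer of $z\mapsto f(z)+\tfrac12\|x-z\|^2$, and $\operatorname{proj}_C=\operatorname{prox}_{\iota_C}$, where $\iota_C$ is the indicator function of a nonempty closed convex set $C$. For $\xi\in[0,+\infty[$, set $\xi\odot f=\xi f$ if $\xi>0$ and $0\odot f=\iota_{\overline{\operatorname{dom}}f}$. Let $f^{\blacktriangledown}$ be the biconjugate of the function equal to $f$ on $\{-\infty<f<0\}$ and to $+\infty$ elsewhere. Let $\varphi\in\Gamma_0(\mathcal H)$ and $s\colon\mathcal G\to[-\infty,+\infty]$ be such that $\varphi^*(\mathcal H)\subset[0,+\infty]$, $(\varphi^*)^{-1}(]0,+\infty[)\neq\varnothing$, $-s\in\Gamma_0(\mathcal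 G)$, and $S=s^{-1}(]0,+\infty[)\neq\varnothing$. Let $\varphi\rhd s$ be the perspective of $\varphi$ with respect to $s$, i.e., the largest lower semicontinuous convex function on the Hilbert direct sum $\mathcal H\oplus\mathcal G$ that minorizes the function equal to $s(y)\varphi(x/s(y))$ at $(x,y)$ if $0<s(y)<+\infty$, and to $+\infty$ otherwise. Let $\gamma\in{]0,+\infty[}$ and set $$\begin{aligned} \Omega_1&=\big\{(u,v)\in\mathcal H\times\mathcal G : \varphi^*\big(\operatorname{proj}_{\overline{\operatorname{dom}}\varphi^*}(u/\gamma)\big)=0\ \text{and}\ s(\operatorname{proj}_{\overline S}v)=0\big\},\\ \Omega_2&=\big\{(u,v)\in\mathcal H\times\mathcal G : \varphi^*\big(\operatorname{proj}_{\overline{\operatorname{dom}}\varphi^*}(u/\gamma)\big)\in{]0,+\infty[}\ \text{and}\ s\big(\operatorname{prox}_{\gamma\varphi^*(\operatorname{proj}_{\overline{\operatorname{dom}}\varphi^*}(u/\gamma))(-s)^{\blacktriangledown}}v\big)=0\big\},\\ \Omega_3&=\big\{(u,v)\in\mathcal H\times\mathcal G : s(\operatorname{proj}_{\overline S}v)\in{]0,+\infty[}\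 \text{and}\ \varphi^*\big(\operatorname{prox}_{\frac{s(\operatorname{proj}_{\overline S}v)}{\gamma}\varphi^*}(u/\gamma)\big)=0\big\},\\ \Omega_4&=(\mathcal H\times\mathcal G)\smallsetminus(\Omega_1\cup\Omega_2\cup\Omega_3). \end{aligned}$$ Then every point of $\mathcal H\times\mathcal G$ belongs to exactly one of $\Omega_1,\Omega_2,\Omega_3,\Omega_4$. Moreover, let $x\in\mathcal H$ and $y\in\mathcal G$. Then $\operatorname{prox}_{\gamma(\varphi\rhd s)}(x,y)$ is well defined, there exists a unique $\eta\in[0,+\infty[$ such that $\varphi^*\big(\operatorname{prox}_{\frac{\eta}{\gamma}\odot\varphi^*}(x/\gamma)\big)<+\infty$ and $$(-s)^{\blacktriangledown}\Big(\operatorname{prox}_{\gamma\varphi^*\big(\operatorname{prox}_{\frac{\eta}{\gamma}\odot\varphi^*}(x/\gamma)\big)\odot(-s)^{\blacktriangledown}}\,y\Big)+\eta=0,$$ and, for this $\eta$, exactly one of the following holds: (i) $(x,y)\in\Omega_1$, $\eta=0$, and $\operatorname{prox}_{\gamma(\varphi\rhd s)}(x,y)=\big(x-\gamma\operatorname{proj}_{\overline{\operatorname{dom}}\varphi^*}(x/\gamma),\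 \operatorname{proj}_{\overline S}y\big)$. (ii) $(x,y)\in\Omega_2$, $\eta=0$, and $\operatorname{prox}_{\gamma(\varphi\rhd s)}(x,y)=\big(x-\gamma\operatorname{proj}_{\overline{\operatorname{dom}}\varphi^*}(x/\gamma),\ \operatorname{prox}_{\gamma\varphi^*(\operatorname{proj}_{\overline{\operatorname{dom}}\varphi^*}(x/\gamma))(-s)^{\blacktriangledown}}y\big)$. (iii) $(x,y)\in\Omega_3$, $\eta=s(\operatorname{proj}_{\overline S}y)>0$, and $\operatorname{prox}_{\gamma(\varphi\rhd s)}(x,y)=\big(x-\gamma\operatorname{prox}_{\frac{s(\operatorname{proj}_{\overline S}y)}{\gamma}\varphi^*}(x/\gamma),\ \operatorname{proj}_{\overline S}y\big)$. (iv) $(x,y)\in\Omega_4$, $\eta>0$, the number $\varphi^*\big(\operatorname{prox}_{\frac{\eta}{\gamma}\varphi^*}(x/\gamma)\big)$ lies in $]0,+\infty[$, $\eta$ solves $$\eta=s\Big(\operatorname{prox}_{\gamma\varphi^*\big(\operatorname{prox}_{\frac{\eta}{\gamma}\varphi^*}(x/\gamma)\big)(-s)^{\blacktriangledown}}\,y\Big),$$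 and $$\operatorname{prox}_{\gamma(\varphi\rhd s)}(x,y)=\Big(x-\gamma\operatorname{prox}_{\frac{\eta}{\gamma}\varphi^*}(x/\gamma),\ \operatorname{prox}_{\gamma\varphi^*\big(\operatorname{prox}_{\frac{\eta}{\gamma}\varphi^*}(x/\gamma)\big)(-s)^{\blacktriangledown}}\,y\Big).$$ -/

import Mathlib

namespace NLPersp

/-! Convex analysis of extended-real-valued functions. -/

section Basics

variable {E : Type*} [NormedAddCommGroup E] [InnerProductSpace ℝ E]

/-- The domain `dom f = {x | f x < +∞}`. -/
def dom (f : E → EReal) : Set E := {x | f x < ⊤}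

/-- The epigraph `epi f = {(x, ξ) ∈ E × ℝ | f x ≤ ξ}`. -/
def epi (f : E → EReal) : Set (E × ℝ) := {p | f p.1 ≤ (p.2 : EReal)}

/-- `f` never takes the value `-∞` and is not identically `+∞`. -/
def IsProper (f : E → EReal) : Prop := (∀ x, f x ≠ ⊥) ∧ ∃ x, f x ≠ ⊤

/-- Lower semicontinuous and convex (the latter means that the epigraph is convex). -/
def IsLscConvex (f : E → EReal) : Prop := LowerSemicontinuous f ∧ Convex ℝ (epi f)

/-- `f ∈ Γ₀(E)`: proper, lower semicontinuous, convex. -/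
def IsGammaZero (f : E → EReal) : Prop := IsProper f ∧ IsLscConvex f

/-- The conjugate `f^*(u) = sup_x (⟪x, u⟫ - f x)`. -/
noncomputable def conj (f : E → EReal) : E → EReal :=
  fun u => ⨆ x : E, (((inner ℝ x u : ℝ) : EReal) - f x)

open Classical in
/-- The indicator function `ι_C`: `0` on `C`, and `+∞` elsewhere. -/
noncomputable def indic (C : Set E) : E → EReal := fun x => if x ∈ C then 0 else ⊤

/-- The pointwise multiple `c f` by a real number `c` (used only for `c > 0`). -/
noncomputable def scale (c : ℝ) (f : E → EReal) : E → EReal := fun x => (c : EReal) * f x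

open Classical in
/-- `ξ ⊙ f`, for `ξ ∈ [0, +∞)`: it is `ξ f` if `ξ > 0`, and the indicator function of the
closure of `dom f` if `ξ = 0`. -/
noncomputable def odot (ξ : ℝ) (f : E → EReal) : E → EReal :=
  if ξ = 0 then indic (closure (dom f)) else scale ξ f

/-- `p` is the unique minimizer of `y ↦ f y + ‖x - y‖² / 2`. -/
def IsProx (f : E → EReal) (x p : E) : Prop :=
  ∀ y : E, y ≠ p →
    f p + ((1 / 2 * ‖x - p‖ ^ 2 : ℝ) : EReal) < f y + ((1 / 2 * ‖x - y‖ ^ 2 : ℝ) : EReal)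

open Classical in
/-- The proximity operator `prox_f`: `prox f x` is the unique minimizer of
`y ↦ f y + ‖x - y‖² / 2` (with a dummy value if there is none, which does not happen for
`f ∈ Γ₀(E)` and `E` complete). -/
noncomputable def prox (f : E → EReal) (x : E) : E :=
  if h : ∃ p, IsProx f x p then h.choose else x

theorem IsProx.prox_eq {f : E → EReal} {x p : E} (h : IsProx f x p) : prox f x = p := by
  have hex : ∃ p, IsProx f x p := ⟨p, h⟩
  unfold prox
  rw [dif_pos hex]
  by_contra hne
  exact lt_asymm (h _ hne) (hex.choose_spec p (Ne.symm hne))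

/-- The projection operator `proj_C = prox_{ι_C}` onto a nonempty closed convex set. -/
noncomputable def proj (C : Set E) (x : E) : E := prox (indic C) x

open Classical in
/-- The function equal to `f` where `-∞ < f < 0`, and to `+∞` elsewhere. -/
noncomputable def negPart (f : E → EReal) : E → EReal :=
  fun x => if ⊥ < f x ∧ f x < 0 then f x else ⊤

/-- The `▼` envelope of `f`: the biconjugate of `negPart f`. -/
noncomputable def downEnv (f : E → EReal) : E → EReal := conj (conj (negPart f))

end Basics

section Perspective

variable {H G : Type*} [NormedAddCommGroup H] [InnerProductSpace ℝ H]
  [NormedAddCommGroup G] [InnerProductSpace ℝ G]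

open Classical in
/-- The preperspective of the base function `φ` with respect to the scaling function `s`, as a
function on the Hilbert direct sum of `H` and `G`. -/
noncomputable def preperspective (φ : H → EReal) (s : G → EReal) :
    WithLp 2 (H × G) → EReal :=
  fun z => if 0 < s z.snd ∧ s z.snd < ⊤ then
      s z.snd * φ ((s z.snd).toReal⁻¹ • z.fst)
    else ⊤

/-- The perspective `φ ⊳ s`: the largest lower semicontinuous convex function minorizing the
preperspective, written as the pointwise supremum of all such functions. -/
noncomputable def perspective (φ : H → EReal) (s : G → EReal) : WithLp 2 (H × G) → EReal :=
  sSup {g | IsLscConvex g ∧ g ≤ preperspective φ s}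

/-- The supremum in the definition of `φ ⊳ s` is attained, i.e. it is a largest element. -/
theorem perspective_isGreatest (φ : H → EReal) (s : G → EReal) :
    IsGreatest {g | IsLscConvex g ∧ g ≤ preperspective φ s} (perspective φ s) := by
  refine ⟨⟨⟨?_, ?_⟩, sSup_le fun g hg => hg.2⟩, fun g hg => le_sSup hg⟩
  · have : perspective φ s = fun z =>
        ⨆ g : {g | IsLscConvex g ∧ g ≤ preperspective φ s}, g.1 z := by
      funext z; exact sSup_apply
    rw [this]
    exact lowerSemicontinuous_iSup fun g => g.2.1.1
  · have : epi (perspective φ s) =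
        ⋂ g : {g | IsLscConvex g ∧ g ≤ preperspective φ s}, epi g.1 := by
      ext p
      simp only [epi, perspective, sSup_apply, Set.mem_setOf_eq, Set.mem_iInter, iSup_le_iff]
    rw [this]
    exact convex_iInter fun g => g.2.1.2

/-- The set `S = s⁻¹(]0, +∞[)`. -/
def posSet (s : G → EReal) : Set G := {y | 0 < s y ∧ s y < ⊤}

/-- The function `(-s)^▼`. -/
noncomputable def negEnv (s : G → EReal) : G → EReal := downEnv (fun y => -s y)

/-- The equation
`(-s)^▼ (prox_{c ⊙ (-s)^▼} y) + η = 0`, where `c = γ φ^*(prox_{(η/γ) ⊙ φ^*}(x/γ))`.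
Since `c ⊙ ·` is only defined for real `c ≥ 0`, the equation comprises the requirement that
`φ^*(prox_{(η/γ) ⊙ φ^*}(x/γ))` is finite (which can fail only for `η = 0`, when the projection
of `x/γ` onto the closure of `dom φ^*` is not in `dom φ^*`). -/
def SolvesMain (φ : H → EReal) (s : G → EReal) (γ : ℝ) (x : H) (y : G) (η : ℝ) : Prop :=
  conj φ (prox (odot (η / γ) (conj φ)) (γ⁻¹ • x)) < ⊤ ∧
  negEnv s (prox (odot (γ * (conj φ (prox (odot (η / γ) (conj φ)) (γ⁻¹ • x))).toReal)
    (negEnv s)) y) + (η : EReal) = 0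

noncomputable def Omega1 (φ : H → EReal) (s : G → EReal) (γ : ℝ) : Set (H × G) :=
  {w | conj φ (proj (closure (dom (conj φ))) (γ⁻¹ • w.1)) = 0 ∧
    s (proj (closure (posSet s)) w.2) = 0}

noncomputable def Omega2 (φ : H → EReal) (s : G → EReal) (γ : ℝ) : Set (H × G) :=
  {w | 0 < conj φ (proj (closure (dom (conj φ))) (γ⁻¹ • w.1)) ∧
    conj φ (proj (closure (dom (conj φ))) (γ⁻¹ • w.1)) < ⊤ ∧
    s (prox (scale (γ * (conj φ (proj (closure (dom (conj φ))) (γ⁻¹ • w.1))).toReal)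
      (negEnv s)) w.2) = 0}

noncomputable def Omega3 (φ : H → EReal) (s : G → EReal) (γ : ℝ) : Set (H × G) :=
  {w | conj φ (prox (scale ((s (proj (closure (posSet s)) w.2)).toReal / γ) (conj φ))
      (γ⁻¹ • w.1)) = 0 ∧
    0 < s (proj (closure (posSet s)) w.2) ∧ s (proj (closure (posSet s)) w.2) < ⊤}

noncomputable def Omega4 (φ : H → EReal) (s : G → EReal) (γ : ℝ) : Set (H × G) :=
  (Omega1 φ s γ ∪ Omega2 φ s γ ∪ Omega3 φ s γ)ᶜ

end Perspective

end NLPersp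

open NLPersp

/-! Write `q` for the prox of `(η/γ) ⊙ φ^*` at `x/γ`, `c = φ^*(q)`, and `r` for the prox of `(γ c) ⊙
(-s)^▼` at `y`. If `s r = η`, the two variational inequalities that characterize `q` and `r` are
coupled by the same pair `(η, c)`. Together they say that `(q, (y - r)/γ)` is a subgradient of the
perspective at `(x - γ q, r)`, which makes that point the prox of `γ (φ ⊳ s)` at `(x, y)`
(`isProx_perspective`). The envelope `(-s)^▼` is explicit, namely `-s` on `{s ≥ 0}` and `+∞`
elsewhere (`negEnv_eq`), so the main equation is exactly `s r = η`.

Existence of `η` is a scalar fixed point problem `T η = η`, with `T η = s r`. The value of a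
function at its prox decreases with the parameter, so `η ↦ c` is decreasing, `c ↦ s r` is
increasing, and `T` is decreasing. These values are also continuous in the parameter, and the
intermediate value theorem applies as soon as some `a` satisfies `a ≤ T a`. If `φ^*` is finite at
the projection of `x/γ`, `a = 0` works. Otherwise `c` blows up as `η → 0` (`exists_lt_proxValue`),
which forces `s r` to stay away from `0` (`proxValue_negOnNonneg_le`), and a small `a > 0` works.

Uniqueness of `η` follows from that of the prox: `η` is the value of `s` at its second component.
The four cases record whether `η` and `c` vanish, and uniqueness of `η` also separates `Ω₂` from
`Ω₃`. -/

namespace NLPersp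

/-! ### Affine minorants and Fenchel–Moreau duality. -/

section Affine

variable {E : Type*} [NormedAddCommGroup E] [InnerProductSpace ℝ E]

theorem IsLscConvex.isClosed_epi {f : E → EReal} (hf : IsLscConvex f) : IsClosed (epi f) := by
  have h := lowerSemicontinuous_iff_isClosed_epigraph.1 hf.1
  exact h.preimage (f := fun p : E × ℝ => (p.1, (p.2 : EReal)))
    (continuous_fst.prodMk (continuous_coe_real_ereal.comp continuous_snd))

theorem epi_combo {f : E → EReal} (hf : Convex ℝ (epi f)) {x y : E} {a b t : ℝ}
    (hx : f x ≤ a) (hy : f y ≤ b) (ht0 : 0 ≤ t) (ht1 : t ≤ 1) :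
    f (x + t • (y - x)) ≤ ((a + t * (b - a) : ℝ) : EReal) := by
  have h := hf (x := (x, a)) hx (y := (y, b)) hy (sub_nonneg.2 ht1) ht0 (by ring)
  have e : (1 - t) • (x, a) + t • (y, b) = (x + t • (y - x), a + t * (b - a)) := by
    ext
    · simp only [Prod.fst_add, Prod.smul_fst]; module
    · simp only [Prod.snd_add, Prod.smul_snd, smul_eq_mul]; ring
  rw [e] at h
  exact h

theorem IsGammaZero.exists_le {f : E → EReal} (hf : IsGammaZero f) :
    ∃ x, ∃ a : ℝ, f x = a := by
  obtain ⟨x, hx⟩ := hf.1.2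
  exact ⟨x, (f x).toReal, (EReal.coe_toReal hx (hf.1.1 x)).symm⟩

theorem coe_toReal_of_lt_top {α : Type*} {f : α → EReal} (hf : ∀ x, f x ≠ ⊥) {x : α} (hx : f x < ⊤) :
    ((f x).toReal : EReal) = f x :=
  EReal.coe_toReal hx.ne (hf x)

/-- Hahn–Banach for a point below the closed convex epigraph. The vertical slope `β` cannot be
negative because the epigraph is unbounded upwards; it may be zero. -/
theorem IsGammaZero.exists_separation [CompleteSpace E] {f : E → EReal} (hf : IsGammaZero f) {x₀ : E} {ξ : ℝ}
    (h : (ξ : EReal) < f x₀) :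
    ∃ v : E, ∃ β m : ℝ, 0 ≤ β ∧ inner ℝ x₀ v + β * ξ < m ∧
      ∀ (y : E) (t : ℝ), f y ≤ t → m < inner ℝ y v + β * t := by
  have hnot : (x₀, ξ) ∉ epi f := by simpa [epi] using h
  obtain ⟨L, m, h1, h2⟩ := geometric_hahn_banach_point_closed hf.2.2 hf.2.isClosed_epi hnot
  set v := (InnerProductSpace.toDual ℝ E).symm (L.comp (ContinuousLinearMap.inl ℝ E ℝ)) with hv
  have hL : ∀ (y : E) (t : ℝ), L (y, t) = inner ℝ y v + L (0, 1) * t := by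
    intro y t
    have e1 : inner ℝ y v = L (y, 0) := by
      rw [real_inner_comm, hv, InnerProductSpace.toDual_symm_apply]; simp
    have e2 : L (0, 1) * t = L (0, t) := by
      have : ((0 : E), t) = t • ((0 : E), (1 : ℝ)) := by simp
      rw [this, map_smul, smul_eq_mul, mul_comm]
    rw [e1, e2, ← map_add]; simp
  have h2' : ∀ (y : E) (t : ℝ), f y ≤ t → m < inner ℝ y v + L (0, 1) * t := fun y t ht => by
    rw [← hL]; exact h2 _ ht
  refine ⟨v, L (0, 1), m, ?_, by rwa [← hL], h2'⟩
  by_contra! hneg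
  obtain ⟨x₁, a, ha⟩ := hf.exists_le
  have h3 := h2' x₁ (max a ((m - inner ℝ x₁ v) / L (0, 1)))
    (ha.le.trans (by exact_mod_cast le_max_left _ _))
  have h4 := mul_le_mul_of_nonpos_left
    (le_max_right a ((m - inner ℝ x₁ v) / L (0, 1))) hneg.le
  rw [mul_div_cancel₀ _ hneg.ne] at h4
  linarith

theorem exists_affine_of_pos {f : E → EReal} {x₀ v : E} {ξ β m : ℝ} (hβ : 0 < β)
    (h : inner ℝ x₀ v + β * ξ < m) (hm : ∀ (y : E) (t : ℝ), f y ≤ t → m < inner ℝ y v + β * t) :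
    ∃ u : E, ∃ b : ℝ, (∀ (y : E) (t : ℝ), f y ≤ t → inner ℝ y u - b ≤ t) ∧
      ξ < inner ℝ x₀ u - b := by
  have key : ∀ y, inner ℝ y ((-β⁻¹) • v) - (-(m / β)) = (m - inner ℝ y v) / β := by
    intro y; rw [inner_smul_right]; field_simp; ring
  refine ⟨(-β⁻¹) • v, -(m / β), fun y t ht => ?_, ?_⟩
  · rw [key, div_le_iff₀ hβ]; linarith [hm y t ht]
  · rw [key, lt_div_iff₀ hβ]; linarith

theorem IsGammaZero.exists_affine [CompleteSpace E] {f : E → EReal} (hf : IsGammaZero f) {x₀ : E} {ξ : ℝ}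
    (h : (ξ : EReal) < f x₀) :
    ∃ u : E, ∃ b : ℝ, (∀ (y : E) (t : ℝ), f y ≤ t → inner ℝ y u - b ≤ t) ∧
      ξ < inner ℝ x₀ u - b := by
  obtain ⟨v, β, m, hβ, h1, h2⟩ := hf.exists_separation h
  rcases hβ.lt_or_eq with hβ | rfl
  · exact exists_affine_of_pos hβ h1 h2
  obtain ⟨x₁, a, ha⟩ := hf.exists_le
  have hlt : ((a - 1 : ℝ) : EReal) < f x₁ := by rw [ha]; exact_mod_cast sub_one_lt a
  obtain ⟨u, b, hu, -⟩ : ∃ u : E, ∃ b : ℝ,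
      (∀ (y : E) (t : ℝ), f y ≤ t → inner ℝ y u - b ≤ t) ∧ a - 1 < inner ℝ x₁ u - b := by
    obtain ⟨v', β', m', hβ', h1', h2'⟩ := hf.exists_separation hlt
    refine exists_affine_of_pos (lt_of_le_of_ne hβ' ?_) h1' h2'
    rintro rfl
    linarith [h2' x₁ a ha.le]
  -- The hyperplane is vertical: `m - ⟪y, v⟫` is negative on `dom f` and positive at `x₀`. Adding a
  -- large multiple of it to any affine minorant keeps a minorant and lifts its value at `x₀` above
  -- `ξ`.
  simp only [zero_mul, add_zero] at h1 h2
  have hd : 0 < m - inner ℝ x₀ v := by linarith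
  obtain ⟨k, hk0, hk⟩ : ∃ k : ℝ, 0 ≤ k ∧ ξ < inner ℝ x₀ u - b + k * (m - inner ℝ x₀ v) := by
    refine ⟨(|ξ - (inner ℝ x₀ u - b)| + 1) / (m - inner ℝ x₀ v), by positivity, ?_⟩
    rw [div_mul_cancel₀ _ hd.ne']
    linarith [le_abs_self (ξ - (inner ℝ x₀ u - b))]
  have key : ∀ y, inner ℝ y (u - k • v) - (b - k * m) =
      inner ℝ y u - b + k * (m - inner ℝ y v) := by
    intro y; rw [inner_sub_right, inner_smul_right]; ring
  refine ⟨u - k • v, b - k * m, fun y t ht => ?_, by rwa [key]⟩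
  rw [key]
  have := mul_nonpos_of_nonneg_of_nonpos hk0 (sub_nonpos.2 (h2 y t ht).le)
  linarith [hu y t ht]

/-- Quantifying over real upper bounds of `f y` removes infinite values from all later computations
with conjugates. -/
theorem conj_le_iff {f : E → EReal} {u : E} {b : ℝ} :
    conj f u ≤ b ↔ ∀ (y : E) (t : ℝ), f y ≤ t → inner ℝ y u - b ≤ t := by
  rw [conj, iSup_le_iff]
  refine forall_congr' fun y => ?_
  induction h : f y with
  | bot =>
    simp only [EReal.coe_sub_bot, top_le_iff, EReal.coe_ne_top, bot_le, forall_const, false_iff,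
      not_forall, not_le]
    exact ⟨inner ℝ y u - b - 1, by linarith⟩
  | top => simp
  | coe a =>
    rw [← EReal.coe_sub, EReal.coe_le_coe_iff]
    simp only [EReal.coe_le_coe_iff]
    exact ⟨fun h t ht => by linarith, fun h => by linarith [h a le_rfl]⟩

/-- The Fenchel–Moreau theorem: the biconjugate of `f` dominates `f`. -/
theorem IsGammaZero.le_of_conj [CompleteSpace E] {f : E → EReal} (hf : IsGammaZero f) {x : E} {c : ℝ}
    (h : ∀ (u : E) (b : ℝ), conj f u ≤ b → inner ℝ x u - b ≤ c) : f x ≤ c := by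
  by_contra! hlt
  obtain ⟨u, b, h1, h2⟩ := hf.exists_affine hlt
  linarith [h u b (conj_le_iff.2 h1)]

theorem isLscConvex_conj (f : E → EReal) : IsLscConvex (conj f) := by
  constructor
  · refine lowerSemicontinuous_iSup fun x => ?_
    induction h : f x with
    | bot => simpa using lowerSemicontinuous_const
    | top => simpa using lowerSemicontinuous_const
    | coe a =>
      simp_rw [← EReal.coe_sub]
      exact (continuous_coe_real_ereal.comp (by fun_prop)).lowerSemicontinuous
  · rintro ⟨u, a⟩ hu ⟨v, b⟩ hv s t hs ht hst
    simp only [epi, Set.mem_ofPred_eq, conj_le_iff, Prod.smul_mk, Prod.mk_add_mk] at hu hv ⊢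
    intro y c hc
    have h1 := mul_le_mul_of_nonneg_left (hu y c hc) hs
    have h2 := mul_le_mul_of_nonneg_left (hv y c hc) ht
    have h3 : c = s * c + t * c := by rw [← add_mul, hst, one_mul]
    rw [inner_add_right, inner_smul_right, inner_smul_right, smul_eq_mul, smul_eq_mul]
    linarith

theorem IsGammaZero.conj [CompleteSpace E] {f : E → EReal} (hf : IsGammaZero f) : IsGammaZero (conj f) := by
  obtain ⟨x, a, ha⟩ := hf.exists_le
  refine ⟨⟨fun u hu => ?_, ?_⟩, isLscConvex_conj f⟩
  · have := (conj_le_iff (b := inner ℝ x u - a - 1)).1 (hu.le.trans bot_le) x a ha.le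
    linarith
  · have hlt : ((a - 1 : ℝ) : EReal) < f x := by rw [ha]; exact_mod_cast sub_one_lt a
    obtain ⟨u, b, h1, -⟩ := hf.exists_affine hlt
    exact ⟨u, ((conj_le_iff.2 h1).trans_lt (EReal.coe_lt_top b)).ne⟩

end Affine

/-! ### Proximity operators: existence and variational inequality. -/

section Prox

variable {E : Type*} [NormedAddCommGroup E] [InnerProductSpace ℝ E]

theorem le_of_forall_le_add_mul {a b N : ℝ} (h : ∀ t : ℝ, 0 < t → t ≤ 1 → a ≤ b + t * N) :
    a ≤ b := by
  have hlim : Filter.Tendsto (fun t : ℝ => b + t * N) (nhdsWithin 0 (Set.Ioi 0))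
      (nhds (b + 0 * N)) :=
    ((continuous_const.add (continuous_id.mul continuous_const)).tendsto 0).mono_left
      nhdsWithin_le_nhds
  rw [zero_mul, add_zero] at hlim
  refine ge_of_tendsto hlim ?_
  filter_upwards [Ioc_mem_nhdsGT (zero_lt_one (α := ℝ))] with t ht using h t ht.1 ht.2

theorem prox_objective_lt_iff {a b c d : ℝ} :
    (a : EReal) + (b : EReal) < (c : EReal) + (d : EReal) ↔ a + b < c + d := by
  rw [← EReal.coe_add, ← EReal.coe_add, EReal.coe_lt_coe_iff]

/-- Expanding `‖x - y‖²` around `p` leaves a surplus `‖y - p‖² / 2`, which gives the strict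
inequality. Only an upper bound on `h p` is needed. -/
theorem isProx_of_variational {h : E → EReal} {x p : E} {a : ℝ} (hp : h p ≤ a)
    (hv : ∀ (z : E) (b : ℝ), h z ≤ b → inner ℝ (z - p) (x - p) ≤ b - a) : IsProx h x p := by
  intro y hy
  have hpos : 0 < ‖y - p‖ ^ 2 := by
    have := norm_pos_iff.2 (sub_ne_zero.2 hy); positivity
  have e : ‖x - y‖ ^ 2 = ‖x - p‖ ^ 2 - 2 * inner ℝ (y - p) (x - p) + ‖y - p‖ ^ 2 := by
    have : x - y = (x - p) - (y - p) := by abel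
    rw [this, norm_sub_sq_real, real_inner_comm]
  refine lt_of_le_of_lt (add_le_add_left hp _) ?_
  induction hb : h y with
  | bot =>
    have := hv y (inner ℝ (y - p) (x - p) + a - 1) (hb.le.trans bot_le)
    linarith
  | top => rw [EReal.top_add_coe, ← EReal.coe_add]; exact EReal.coe_lt_top _
  | coe b =>
    rw [prox_objective_lt_iff]
    linarith [hv y b hb.le]

/-- Compare `p` with `p + t (z - p)`, divide by `t`, and let `t` tend to `0`. -/
theorem IsProx.variational {h : E → EReal} (hc : Convex ℝ (epi h)) {x p : E} (hx : IsProx h x p)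
    {a : ℝ} (hp : h p = a) {z : E} {b : ℝ} (hz : h z ≤ b) :
    inner ℝ (z - p) (x - p) ≤ b - a := by
  rcases eq_or_ne z p with rfl | hne
  · rw [hp, EReal.coe_le_coe_iff] at hz
    simpa using hz
  have key : ∀ t : ℝ, 0 < t → t ≤ 1 →
      inner ℝ (z - p) (x - p) ≤ b - a + t * (1 / 2 * ‖z - p‖ ^ 2) := by
    intro t ht0 ht1
    have h1 := hx (p + t • (z - p)) (by simp [ht0.ne', sub_ne_zero.2 hne])
    have h2 := h1.trans_le (add_le_add_left (epi_combo hc hp.le hz ht0.le ht1) _)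
    rw [hp, prox_objective_lt_iff] at h2
    have e : ‖x - (p + t • (z - p))‖ ^ 2 =
        ‖x - p‖ ^ 2 - 2 * (t * inner ℝ (z - p) (x - p)) + t ^ 2 * ‖z - p‖ ^ 2 := by
      have : x - (p + t • (z - p)) = (x - p) - t • (z - p) := by abel
      rw [this, norm_sub_sq_real, inner_smul_right, real_inner_comm, norm_smul, mul_pow,
        Real.norm_eq_abs, sq_abs]
    rw [e] at h2
    have h3 : t * inner ℝ (z - p) (x - p) < t * (b - a + t * (1 / 2 * ‖z - p‖ ^ 2)) := by
      linarith
    exact (lt_of_mul_lt_mul_left h3 ht0.le).le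
  exact le_of_forall_le_add_mul key

theorem norm_sub_midpoint_sq (x y z : E) :
    ‖x - (y + (1 / 2 : ℝ) • (z - y))‖ ^ 2 =
      1 / 2 * ‖x - y‖ ^ 2 + 1 / 2 * ‖x - z‖ ^ 2 - 1 / 4 * ‖y - z‖ ^ 2 := by
  have e1 : x - (y + (1 / 2 : ℝ) • (z - y)) = (1 / 2 : ℝ) • ((x - y) + (x - z)) := by module
  have e2 : y - z = (x - z) - (x - y) := by abel
  rw [e1, e2, norm_smul, mul_pow, norm_add_sq_real (x - y), norm_sub_sq_real (x - z),
    real_inner_comm (x - y)]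
  norm_num
  ring

open Filter Topology in
-- Direct method: an affine minorant bounds the objective below, the midpoint identity makes
-- minimizing sequences Cauchy, and closedness of the epigraph puts the limit at the minimum.
theorem exists_isProx [CompleteSpace E] {h : E → EReal} (hbot : ∀ x, h x ≠ ⊥)
    (hcl : IsClosed (epi h)) (hc : Convex ℝ (epi h)) (hne : ∃ x, ∃ a : ℝ, h x ≤ a)
    {u : E} {β : ℝ} (hβ : ∀ (y : E) (t : ℝ), h y ≤ t → inner ℝ y u - β ≤ t) (x : E) :
    ∃ p, IsProx h x p := by
  set A : Set ℝ := {r | ∃ y, ∃ b : ℝ, h y ≤ b ∧ r = b + 1 / 2 * ‖x - y‖ ^ 2} with hA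
  have hAne : A.Nonempty := by
    obtain ⟨y, b, hy⟩ := hne
    exact ⟨_, y, b, hy, rfl⟩
  have hAb : BddBelow A := by
    -- The minimum over `y` of `⟪y, u⟫ - β + ‖x - y‖² / 2`, attained at `y = x - u`.
    refine ⟨inner ℝ x u - β - 1 / 2 * ‖u‖ ^ 2, ?_⟩
    rintro r ⟨y, b, hy, rfl⟩
    have h1 := hβ y b hy
    have h2 : inner ℝ y u = inner ℝ x u - inner ℝ (x - y) u := by rw [inner_sub_left]; ring
    have h3 := norm_sub_sq_real (x - y) u
    nlinarith [sq_nonneg ‖x - y - u‖]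
  set m := sInf A with hm
  have hlow : ∀ (y : E) (b : ℝ), h y ≤ b → m ≤ b + 1 / 2 * ‖x - y‖ ^ 2 := fun y b hy =>
    csInf_le hAb ⟨y, b, hy, rfl⟩
  have hmid : ∀ (y z : E) (b c : ℝ), h y ≤ b → h z ≤ c →
      1 / 4 * ‖y - z‖ ^ 2 ≤ (b + 1 / 2 * ‖x - y‖ ^ 2 - m) + (c + 1 / 2 * ‖x - z‖ ^ 2 - m) := by
    intro y z b c hy hz
    have h1 := hlow _ _ (epi_combo hc hy hz (t := 1 / 2) (by norm_num) (by norm_num))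
    rw [norm_sub_midpoint_sq] at h1
    linarith
  have hseq : ∀ n : ℕ, ∃ y, ∃ b : ℝ, h y ≤ b ∧
      b + 1 / 2 * ‖x - y‖ ^ 2 < m + 1 / ((n : ℝ) + 1) := by
    intro n
    obtain ⟨r, ⟨y, b, hy, rfl⟩, hr⟩ := Real.lt_sInf_add_pos hAne (Nat.one_div_pos_of_nat (n := n))
    exact ⟨y, b, hy, hr⟩
  choose y b hy hb using hseq
  have hcau : CauchySeq y := by
    rw [Metric.cauchySeq_iff']
    intro ε hε
    obtain ⟨N, hN⟩ := exists_nat_one_div_lt (show (0 : ℝ) < ε ^ 2 / 8 by positivity)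
    refine ⟨N, fun n hn => ?_⟩
    have h1 := hmid _ _ _ _ (hy n) (hy N)
    have h2 : 1 / ((n : ℝ) + 1) ≤ 1 / ((N : ℝ) + 1) := Nat.one_div_le_one_div hn
    rw [dist_eq_norm]
    refine lt_of_pow_lt_pow_left₀ 2 hε.le ?_
    linarith [hb n, hb N]
  obtain ⟨p, hp⟩ := cauchySeq_tendsto_of_complete hcau
  have hlim : Tendsto (fun n => (y n, m + 1 / ((n : ℝ) + 1) - 1 / 2 * ‖x - y n‖ ^ 2)) atTop
      (𝓝 (p, m + 0 - 1 / 2 * ‖x - p‖ ^ 2)) :=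
    hp.prodMk_nhds ((tendsto_const_nhds.add tendsto_one_div_add_atTop_nhds_zero_nat).sub
      (((tendsto_const_nhds.sub hp).norm.pow 2).const_mul _))
  have hpe := hcl.mem_of_tendsto hlim (Eventually.of_forall fun n =>
    (hy n).trans (EReal.coe_le_coe_iff.2 (by linarith [hb n])))
  have hpm : h p ≤ ((m - 1 / 2 * ‖x - p‖ ^ 2 : ℝ) : EReal) := by simpa [epi] using hpe
  refine ⟨p, fun z hz => lt_of_le_of_lt (add_le_add_left hpm _) ?_⟩
  induction hzc : h z with
  | bot => exact absurd hzc (hbot z)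
  | top => rw [EReal.top_add_coe, ← EReal.coe_add]; exact EReal.coe_lt_top _
  | coe c =>
    rw [prox_objective_lt_iff]
    have h1 := hmid _ _ _ _ hpm hzc.le
    have h2 : 0 < ‖p - z‖ ^ 2 := by
      have := norm_pos_iff.2 (sub_ne_zero.2 hz.symm); positivity
    linarith

theorem coe_mul_le_iff {α : Type*} {t : ℝ} (ht : 0 < t) {f : α → EReal} {x : α} {b : ℝ} :
    (t : EReal) * f x ≤ b ↔ f x ≤ ((b / t : ℝ) : EReal) := by
  induction f x with
  | bot => simp [EReal.coe_mul_bot_of_pos ht]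
  | top => simp [EReal.coe_mul_top_of_pos ht]
  | coe a =>
    rw [← EReal.coe_mul, EReal.coe_le_coe_iff, EReal.coe_le_coe_iff, le_div_iff₀ ht, mul_comm]

theorem indic_le_iff {α : Type*} {C : Set α} {x : α} {b : ℝ} : indic C x ≤ b ↔ x ∈ C ∧ 0 ≤ b := by
  by_cases h : x ∈ C <;> simp [indic, h]

theorem convex_dom {f : E → EReal} (hf : Convex ℝ (epi f)) : Convex ℝ (dom f) := by
  have : dom f = (LinearMap.fst ℝ E ℝ) '' epi f := by
    ext x
    constructor
    · intro hx
      obtain ⟨r, hr, -⟩ := EReal.lt_iff_exists_real_btwn.1 (show f x < ⊤ from hx)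
      exact ⟨(x, r), hr.le, rfl⟩
    · rintro ⟨⟨y, r⟩, hy, rfl⟩
      exact lt_of_le_of_lt hy (EReal.coe_lt_top r)
  rw [this]
  exact hf.linear_image _

theorem epi_indic {α : Type*} (C : Set α) : epi (indic C) = C ×ˢ Set.Ici (0 : ℝ) := by
  ext ⟨y, b⟩
  simpa [epi] using indic_le_iff

/-- The linear map which sends the epigraph of `t f` to that of `f`. -/
noncomputable def epiScale (E : Type*) [NormedAddCommGroup E] [InnerProductSpace ℝ E] (t : ℝ) :
    E × ℝ →L[ℝ] E × ℝ :=
  (ContinuousLinearMap.fst ℝ E ℝ).prod (t⁻¹ • ContinuousLinearMap.snd ℝ E ℝ)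

theorem epi_scale {t : ℝ} (ht : 0 < t) (f : E → EReal) :
    epi (scale t f) = epiScale E t ⁻¹' epi f := by
  ext ⟨y, b⟩
  simp only [epi, Set.mem_ofPred_eq, scale, coe_mul_le_iff ht, Set.mem_preimage, epiScale]
  simp [div_eq_inv_mul]

theorem convex_epi_odot {f : E → EReal} (hf : Convex ℝ (epi f)) {t : ℝ} (ht : 0 ≤ t) :
    Convex ℝ (epi (odot t f)) := by
  rcases ht.eq_or_lt with rfl | ht
  · rw [odot, if_pos rfl, epi_indic]
    exact (convex_dom hf).closure.prod (convex_Ici 0)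
  · rw [odot, if_neg ht.ne', epi_scale ht]
    exact hf.linear_preimage (epiScale E t).toLinearMap

theorem isClosed_epi_odot {f : E → EReal} (hf : IsLscConvex f) {t : ℝ} (ht : 0 ≤ t) :
    IsClosed (epi (odot t f)) := by
  rcases ht.eq_or_lt with rfl | ht
  · rw [odot, if_pos rfl, epi_indic]
    exact isClosed_closure.prod isClosed_Ici
  · rw [odot, if_neg ht.ne', epi_scale ht]
    exact hf.isClosed_epi.preimage (epiScale E t).continuous

/-- The proximity operator of `t ⊙ f`. -/
theorem IsGammaZero.isProx_odot [CompleteSpace E] {f : E → EReal} (hf : IsGammaZero f) {t : ℝ}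
    (ht : 0 ≤ t) (x : E) : IsProx (odot t f) x (prox (odot t f) x) := by
  suffices h : ∃ p, IsProx (odot t f) x p by
    obtain ⟨p, hp⟩ := h
    rwa [hp.prox_eq]
  obtain ⟨x₁, a, ha⟩ := hf.exists_le
  have hcl := isClosed_epi_odot hf.2 ht
  have hcv := convex_epi_odot hf.2.2 ht
  rcases ht.eq_or_lt with rfl | ht
  · rw [odot, if_pos rfl] at hcl hcv ⊢
    refine exists_isProx (u := 0) (β := 0) (fun y => ?_) hcl hcv
      ⟨x₁, 0, indic_le_iff.2 ⟨?_, le_rfl⟩⟩ (fun y t hy => ?_) x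
    · unfold indic; split_ifs <;> simp
    · exact subset_closure (show f x₁ < ⊤ by rw [ha]; exact EReal.coe_lt_top a)
    · simpa using (indic_le_iff.1 hy).2
  · rw [odot, if_neg ht.ne'] at hcl hcv ⊢
    have hlt : ((a - 1 : ℝ) : EReal) < f x₁ := by rw [ha]; exact_mod_cast sub_one_lt a
    obtain ⟨u, β, hβ, -⟩ := hf.exists_affine hlt
    refine exists_isProx (u := t • u) (β := t * β) (fun y hy => ?_) hcl hcv
      ⟨x₁, t * a, by rw [scale, ha, EReal.coe_mul]⟩ (fun y b hy => ?_) x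
    · have := (coe_mul_le_iff ht (b := t * (inner ℝ y u - β - 1))).1 (hy.le.trans bot_le)
      rw [mul_div_cancel_left₀ _ ht.ne'] at this
      linarith [hβ y _ this]
    · have := hβ y _ ((coe_mul_le_iff ht).1 hy)
      rw [le_div_iff₀ ht] at this
      rw [inner_smul_right]; linarith

theorem IsGammaZero.prox_odot_lt_top [CompleteSpace E] {f : E → EReal} (hf : IsGammaZero f)
    {t : ℝ} (ht : 0 < t) (x : E) : f (prox (odot t f) x) < ⊤ := by
  have h := hf.isProx_odot ht.le x
  set p := prox (odot t f) x
  by_contra! htop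
  rw [top_le_iff] at htop
  obtain ⟨x₁, a, ha⟩ := hf.exists_le
  have hne : x₁ ≠ p := by rintro rfl; simp [htop] at ha
  have := h x₁ hne
  rw [odot, if_neg ht.ne', scale, scale, htop, EReal.coe_mul_top_of_pos ht, EReal.top_add_coe]
    at this
  exact not_top_lt this

theorem IsGammaZero.proj_mem [CompleteSpace E] {f : E → EReal} (hf : IsGammaZero f) (x : E) :
    prox (odot 0 f) x ∈ closure (dom f) := by
  have h := hf.isProx_odot le_rfl x
  set p := prox (odot 0 f) x
  by_contra hp
  obtain ⟨x₁, a, ha⟩ := hf.exists_le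
  have hx₁ : x₁ ∈ closure (dom f) :=
    subset_closure (show f x₁ < ⊤ by rw [ha]; exact EReal.coe_lt_top a)
  have := h x₁ (by rintro rfl; exact hp hx₁)
  rw [odot, if_pos rfl, indic, if_neg hp, EReal.top_add_coe] at this
  exact not_top_lt this

theorem IsGammaZero.proj_variational [CompleteSpace E] {f : E → EReal} (hf : IsGammaZero f)
    (x : E) {z : E} (hz : f z < ⊤) :
    inner ℝ (z - prox (odot 0 f) x) (x - prox (odot 0 f) x) ≤ 0 := by
  have h := (hf.isProx_odot le_rfl x).variational (convex_epi_odot hf.2.2 le_rfl) (a := 0)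
    (z := z) (b := 0) (by
      have hm := hf.proj_mem x
      rw [odot, if_pos rfl] at hm ⊢
      rw [indic, if_pos hm, EReal.coe_zero])
    (by rw [odot, if_pos rfl]; exact indic_le_iff.2 ⟨subset_closure hz, le_rfl⟩)
  rwa [sub_zero] at h

/-- The variational inequality which characterizes the proximity operator of `t ⊙ f`. -/
theorem IsGammaZero.prox_odot_variational [CompleteSpace E] {f : E → EReal} (hf : IsGammaZero f)
    {t : ℝ} (ht : 0 ≤ t) (x : E) {a : ℝ} (ha : f (prox (odot t f) x) = a) {z : E} {b : ℝ}
    (hz : f z ≤ b) :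
    inner ℝ (z - prox (odot t f) x) (x - prox (odot t f) x) ≤ t * (b - a) := by
  rcases ht.eq_or_lt with rfl | ht
  · rw [zero_mul]
    exact hf.proj_variational x (hz.trans_lt (EReal.coe_lt_top b))
  have ho : odot t f = scale t f := if_neg ht.ne'
  have h := (hf.isProx_odot ht.le x).variational (convex_epi_odot hf.2.2 ht.le) (a := t * a)
    (z := z) (b := t * b) (by rw [ho, scale, ← ho, ha, EReal.coe_mul])
    (by rw [ho, scale, coe_mul_le_iff ht, mul_div_cancel_left₀ _ ht.ne']; exact hz)
  linarith

end Prox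

/-! ### Dependence of the proximal value on the parameter. -/

section Path

open Filter Topology

variable {E : Type*} [NormedAddCommGroup E] [InnerProductSpace ℝ E]

/-- The value of `f` at the proximal point of `t ⊙ f`. -/
noncomputable def proxValue (f : E → EReal) (x : E) (t : ℝ) : ℝ :=
  (f (prox (odot t f) x)).toReal

variable {f : E → EReal}

theorem IsGammaZero.coe_proxValue (hf : IsGammaZero f) {x : E} {t : ℝ}
    (h : f (prox (odot t f) x) < ⊤) : f (prox (odot t f) x) = proxValue f x t :=
  (coe_toReal_of_lt_top hf.1.1 h).symm

variable [CompleteSpace E]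

/-- Sum of the variational inequalities at the two proximal points, each tested at the other. It
yields both monotonicity of the value and control of the displacement. -/
theorem IsGammaZero.norm_prox_sub_sq_le (hf : IsGammaZero f) {x : E} {s t : ℝ} (hs : 0 ≤ s)
    (ht : 0 ≤ t) (hfs : f (prox (odot s f) x) < ⊤) (hft : f (prox (odot t f) x) < ⊤) :
    ‖prox (odot s f) x - prox (odot t f) x‖ ^ 2 ≤
      (t - s) * (proxValue f x s - proxValue f x t) := by
  have es := hf.coe_proxValue hfs
  have et := hf.coe_proxValue hft
  have h1 := hf.prox_odot_variational hs x es et.le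
  have h2 := hf.prox_odot_variational ht x et es.le
  set p := prox (odot s f) x
  set q := prox (odot t f) x
  have e : ‖p - q‖ ^ 2 = inner ℝ (q - p) (x - p) + inner ℝ (p - q) (x - q) := by
    rw [← real_inner_self_eq_norm_sq, ← neg_sub p q, inner_neg_left, neg_add_eq_sub,
      ← inner_sub_right]
    congr 1; abel
  linarith

theorem IsGammaZero.proxValue_anti (hf : IsGammaZero f) {x : E} {s t : ℝ} (hs : 0 ≤ s)
    (hst : s ≤ t) (hfs : f (prox (odot s f) x) < ⊤) : proxValue f x t ≤ proxValue f x s := by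
  rcases hst.eq_or_lt with rfl | hlt
  · rfl
  have h := hf.norm_prox_sub_sq_le hs (hs.trans hst) hfs (hf.prox_odot_lt_top (hs.trans_lt hlt) x)
  have h0 := (sq_nonneg _).trans h
  linarith [nonneg_of_mul_nonneg_right h0 (sub_pos.2 hlt)]

/-- With `d` the displacement and `R = ‖x - p‖`, one variational inequality gives `(s/2) |b - a| ≤ d
R`, and `d² ≤ |t - s| |b - a|` by `norm_prox_sub_sq_le`. Squaring the first and cancelling `|b - a|`
gives the Lipschitz bound. -/
theorem IsGammaZero.abs_proxValue_sub_le (hf : IsGammaZero f) {x : E} {s t : ℝ} (hs : 0 < s)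
    (ht : s / 2 ≤ t) :
    |proxValue f x t - proxValue f x s| ≤ (2 * ‖x - prox (odot s f) x‖ / s) ^ 2 * |t - s| := by
  have ht0 : 0 < t := by linarith
  have hfs := hf.prox_odot_lt_top hs x
  have hft := hf.prox_odot_lt_top ht0 x
  have h0 := hf.norm_prox_sub_sq_le hs.le ht0.le hfs hft
  have es := hf.coe_proxValue hfs
  have et := hf.coe_proxValue hft
  have h1 := hf.prox_odot_variational hs.le x es et.le
  have h2 := hf.prox_odot_variational ht0.le x et es.le
  set p := prox (odot s f) x
  set q := prox (odot t f) x
  set a := proxValue f x s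
  set b := proxValue f x t
  have e1 : inner ℝ (q - p) (x - p) = -inner ℝ (p - q) (x - p) := by
    rw [← inner_neg_left, neg_sub]
  have e2 : inner ℝ (p - q) (x - q) = inner ℝ (p - q) (x - p) + ‖p - q‖ ^ 2 := by
    rw [← real_inner_self_eq_norm_sq, ← inner_add_right]; congr 1; abel
  have h3 := abs_le.1 (abs_real_inner_le_norm (p - q) (x - p))
  set d := ‖p - q‖
  set R := ‖x - p‖
  have h5 : s / 2 * |b - a| ≤ d * R := by
    rcases abs_cases (b - a) with ⟨h, hn⟩ | ⟨h, hn⟩ <;> rw [h]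
    · nlinarith [sq_nonneg d]
    · nlinarith
  have h6 : d ^ 2 ≤ |t - s| * |b - a| := by
    rw [← abs_mul]
    exact h0.trans ((le_abs_self _).trans_eq (by rw [← abs_neg]; congr 1; ring))
  rcases (abs_nonneg (b - a)).eq_or_lt with h7 | h7
  · rw [← h7]; positivity
  have h8 : (s / 2 * |b - a|) ^ 2 ≤ R ^ 2 * (|t - s| * |b - a|) :=
    calc (s / 2 * |b - a|) ^ 2 ≤ (d * R) ^ 2 := pow_le_pow_left₀ (by positivity) h5 2
      _ = R ^ 2 * d ^ 2 := by ring
      _ ≤ _ := mul_le_mul_of_nonneg_left h6 (sq_nonneg R)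
  have h9 : s ^ 2 / 4 * |b - a| ≤ R ^ 2 * |t - s| := by
    refine le_of_mul_le_mul_right ?_ h7
    linarith
  have h10 : (2 * R / s) ^ 2 * |t - s| = R ^ 2 * |t - s| / (s ^ 2 / 4) := by field_simp; ring
  rw [h10, le_div_iff₀ (by positivity)]
  linarith

theorem IsGammaZero.continuousAt_proxValue (hf : IsGammaZero f) (x : E) {s : ℝ} (hs : 0 < s) :
    ContinuousAt (proxValue f x) s := by
  rw [ContinuousAt, tendsto_iff_dist_tendsto_zero]
  have hlim : Tendsto (fun t => (2 * ‖x - prox (odot s f) x‖ / s) ^ 2 * |t - s|) (𝓝 s)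
      (𝓝 ((2 * ‖x - prox (odot s f) x‖ / s) ^ 2 * |s - s|)) :=
    (by fun_prop : Continuous
      fun t : ℝ => (2 * ‖x - prox (odot s f) x‖ / s) ^ 2 * |t - s|).tendsto s
  rw [sub_self, abs_zero, mul_zero] at hlim
  refine squeeze_zero' (Eventually.of_forall fun t => dist_nonneg) ?_ hlim
  filter_upwards [lt_mem_nhds (half_lt_self hs)] with t ht
  rw [Real.dist_eq]
  exact hf.abs_proxValue_sub_le hs ht.le

theorem IsGammaZero.continuousWithinAt_proxValue_zero (hf : IsGammaZero f) {x : E}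
    (h0 : f (prox (odot 0 f) x) < ⊤) : ContinuousWithinAt (proxValue f x) (Set.Ici 0) 0 := by
  have e0 := hf.coe_proxValue h0
  have hfin : ∀ t : ℝ, 0 ≤ t → f (prox (odot t f) x) < ⊤ := fun t ht => by
    rcases ht.eq_or_lt with rfl | ht
    exacts [h0, hf.prox_odot_lt_top ht x]
  have hbd : ∀ t ∈ Set.Icc (0 : ℝ) 1, ‖prox (odot t f) x - prox (odot 0 f) x‖ ^ 2 ≤
      t * (proxValue f x 0 - proxValue f x 1) := fun t ht => by
    rw [norm_sub_rev]
    refine (hf.norm_prox_sub_sq_le le_rfl ht.1 h0 (hfin t ht.1)).trans ?_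
    rw [sub_zero]
    exact mul_le_mul_of_nonneg_left
      (sub_le_sub_left (hf.proxValue_anti ht.1 ht.2 (hfin t ht.1)) _) ht.1
  have hev : ∀ᶠ t in 𝓝[≥] (0 : ℝ), t ∈ Set.Icc (0 : ℝ) 1 := Icc_mem_nhdsGE zero_lt_one
  have hp : Tendsto (fun t => prox (odot t f) x) (𝓝[≥] 0) (𝓝 (prox (odot 0 f) x)) := by
    rw [tendsto_iff_norm_sub_tendsto_zero]
    have hlim : Tendsto (fun t => √(t * (proxValue f x 0 - proxValue f x 1))) (𝓝[≥] 0)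
        (𝓝 √(0 * (proxValue f x 0 - proxValue f x 1))) :=
      ((by fun_prop : Continuous
        fun t : ℝ => √(t * (proxValue f x 0 - proxValue f x 1))).tendsto 0).mono_left
        nhdsWithin_le_nhds
    rw [zero_mul, Real.sqrt_zero] at hlim
    refine squeeze_zero' (Eventually.of_forall fun t => norm_nonneg _) ?_ hlim
    filter_upwards [hev] with t ht
    exact Real.le_sqrt_of_sq_le (hbd t ht)
  -- The lower bound is lower semicontinuity of `f` along the convergent proximal points; the upper
  -- bound is monotonicity.
  refine tendsto_order.2 ⟨fun a ha => ?_, fun b hb => ?_⟩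
  · have hlt : (a : EReal) < f (prox (odot 0 f) x) := by rw [e0]; exact_mod_cast ha
    filter_upwards [hp.eventually (hf.2.1 _ _ hlt), hev] with t ht ht'
    rw [hf.coe_proxValue (hfin t ht'.1)] at ht
    exact_mod_cast ht
  · filter_upwards [hev] with t ht
    exact (hf.proxValue_anti le_rfl ht.1 h0).trans_lt hb

theorem IsGammaZero.continuousOn_proxValue (hf : IsGammaZero f) {x : E}
    (h0 : f (prox (odot 0 f) x) < ⊤) : ContinuousOn (proxValue f x) (Set.Ici 0) := by
  intro t ht
  rcases (Set.mem_Ici.1 ht).eq_or_lt with rfl | ht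
  exacts [hf.continuousWithinAt_proxValue_zero h0,
    (hf.continuousAt_proxValue x ht).continuousWithinAt]

/-- If the values stayed below `K`, the proximal points would be Cauchy as `t → 0`. Their limit `q`
would satisfy `f q ≤ K` and the variational inequality of the projection onto the closure of `dom
f`, so `f` would be finite at that projection. -/
theorem IsGammaZero.exists_lt_proxValue (hf : IsGammaZero f) {x : E}
    (h0 : f (prox (odot 0 f) x) = ⊤) (K : ℝ) : ∃ t, 0 < t ∧ K < proxValue f x t := by
  by_contra! hK
  have hfin : ∀ t : ℝ, 0 < t → f (prox (odot t f) x) < ⊤ := fun t ht => hf.prox_odot_lt_top ht x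
  set t : ℕ → ℝ := fun n => 1 / ((n : ℝ) + 1) with ht
  have htpos : ∀ n, 0 < t n := fun n => Nat.one_div_pos_of_nat
  have ht1 : ∀ n, t n ≤ 1 := fun n => by
    simpa [ht] using Nat.one_div_le_one_div (α := ℝ) (Nat.zero_le n)
  have htlim : Tendsto t atTop (𝓝 0) := tendsto_one_div_add_atTop_nhds_zero_nat
  set m := proxValue f x 1
  have hm : ∀ n, m ≤ proxValue f x (t n) := fun n =>
    hf.proxValue_anti (htpos n).le (ht1 n) (hfin _ (htpos n))
  have hmK : m ≤ K := hK 1 one_pos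
  set p : ℕ → E := fun n => prox (odot (t n) f) x with hp
  have hcau : CauchySeq p := by
    rw [Metric.cauchySeq_iff']
    intro ε hε
    obtain ⟨N, hN⟩ := exists_nat_one_div_lt (show (0 : ℝ) < ε ^ 2 / (K - m + 1) by
      have : 0 < K - m + 1 := by linarith
      positivity)
    refine ⟨N, fun n hn => ?_⟩
    rw [lt_div_iff₀ (by linarith)] at hN
    have h1 := hf.norm_prox_sub_sq_le (htpos n).le (htpos N).le (hfin _ (htpos n))
      (hfin _ (htpos N))
    have h2 : t n ≤ t N := Nat.one_div_le_one_div hn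
    rw [dist_eq_norm]
    refine lt_of_pow_lt_pow_left₀ 2 hε.le (h1.trans_lt (lt_of_le_of_lt ?_ hN))
    have h3 : proxValue f x (t n) - proxValue f x (t N) ≤ K - m + 1 := by
      linarith [hK _ (htpos n), hm N]
    refine (mul_le_mul_of_nonneg_left h3 (sub_nonneg.2 h2)).trans ?_
    exact mul_le_mul_of_nonneg_right (by linarith [htpos n]) (by linarith)
  obtain ⟨q, hq⟩ := cauchySeq_tendsto_of_complete hcau
  have hqK : f q ≤ K := by
    have : IsClosed (f ⁻¹' Set.Iic (K : EReal)) := hf.2.1.isClosed_preimage _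
    refine this.mem_of_tendsto hq (Eventually.of_forall fun n => ?_)
    change f (p n) ≤ K
    rw [hf.coe_proxValue (hfin _ (htpos n))]
    exact_mod_cast hK _ (htpos n)
  have hvar : ∀ z ∈ dom f, inner ℝ (z - q) (x - q) ≤ 0 := by
    intro z hz
    have e := coe_toReal_of_lt_top hf.1.1 (show f z < ⊤ from hz)
    have hlim : Tendsto (fun n => inner ℝ (z - p n) (x - p n) - t n * ((f z).toReal - m)) atTop
        (𝓝 (inner ℝ (z - q) (x - q) - 0 * ((f z).toReal - m))) :=
      ((tendsto_const_nhds.sub hq).inner (tendsto_const_nhds.sub hq)).sub (htlim.mul_const _)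
    rw [zero_mul, sub_zero] at hlim
    refine le_of_tendsto hlim (Eventually.of_forall fun n => ?_)
    have h1 := hf.prox_odot_variational (htpos n).le x (hf.coe_proxValue (hfin _ (htpos n))) e.ge
    have h2 := mul_le_mul_of_nonneg_left (hm n) (htpos n).le
    simp only [hp]
    linarith
  have hvar' : closure (dom f) ⊆ {z | inner ℝ (z - q) (x - q) ≤ 0} :=
    closure_minimal hvar (isClosed_le (by fun_prop) continuous_const)
  have hq0 : IsProx (odot 0 f) x q := by
    refine isProx_of_variational (a := 0) ?_ fun z b hz => ?_
    · rw [odot, if_pos rfl]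
      exact indic_le_iff.2 ⟨subset_closure (hqK.trans_lt (EReal.coe_lt_top K)), le_rfl⟩
    · rw [odot, if_pos rfl, indic_le_iff] at hz
      have := hvar' hz.1
      rw [Set.mem_ofPred_eq] at this
      linarith [hz.2]
  rw [hq0.prox_eq] at h0
  rw [h0, top_le_iff] at hqK
  exact EReal.coe_ne_top K hqK

end Path

/-! ### Explicit form of `(-s)^▼`. -/

section NegEnv

open Filter Topology

variable {G : Type*} [NormedAddCommGroup G] [InnerProductSpace ℝ G] {s : G → EReal}

open Classical in
/-- The function equal to `-s` where `s` is nonnegative, and to `+∞` elsewhere. -/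
noncomputable def negOnNonneg (s : G → EReal) : G → EReal := fun y => if 0 ≤ s y then -s y else ⊤

theorem neg_le_zero_iff_nonneg {a : EReal} : -a ≤ 0 ↔ 0 ≤ a := by
  rw [EReal.neg_le, neg_zero]

theorem negOnNonneg_le_iff {α : Type*} {s : α → EReal} {y : α} {b : ℝ} : negOnNonneg s y ≤ b ↔ -s y ≤ b ∧ 0 ≤ s y := by
  by_cases h : 0 ≤ s y <;> simp [negOnNonneg, h]

theorem isGammaZero_negOnNonneg (hs : IsGammaZero (fun y => -s y)) (hS : (posSet s).Nonempty) :
    IsGammaZero (negOnNonneg s) := by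
  have hcl : ∀ c : EReal, IsClosed {y | -s y ≤ c} := fun c => hs.2.1.isClosed_preimage c
  refine ⟨⟨fun y => ?_, ?_⟩, ?_, ?_⟩
  · unfold negOnNonneg
    split_ifs
    exacts [hs.1.1 y, top_ne_bot]
  · obtain ⟨y, hy⟩ := hS
    refine ⟨y, ?_⟩
    rw [negOnNonneg, if_pos hy.1.le]
    exact fun h => not_lt_bot (EReal.neg_eq_top_iff.1 h ▸ hy.1)
  · rw [lowerSemicontinuous_iff_isClosed_preimage]
    intro c
    by_cases hc : c = ⊤
    · simp [hc]
    · have : negOnNonneg s ⁻¹' Set.Iic c = {y | -s y ≤ c} ∩ {y | -s y ≤ 0} := by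
        ext y
        by_cases h : 0 ≤ s y <;> simp [negOnNonneg, h, hc]
      rw [this]
      exact (hcl c).inter (hcl 0)
  · have : epi (negOnNonneg s) =
        epi (fun y => -s y) ∩ (Prod.fst ⁻¹' {y | -s y ≤ 0} : Set (G × ℝ)) := by
      ext ⟨y, b⟩
      simp [epi, negOnNonneg_le_iff]
    rw [this]
    refine hs.2.2.inter (Convex.linear_preimage ?_ (LinearMap.fst ℝ G ℝ))
    rintro x hx y hy a b ha hb hab
    have h := hs.2.2 (x := (x, 0)) (by simpa [epi] using hx) (y := (y, 0)) (by simpa [epi] using hy)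
      ha hb hab
    simpa [epi] using h

/-- Moving from a point where `s ≥ 0` towards a point where `s > 0`. -/
theorem neg_segment_le (hs : IsGammaZero (fun y => -s y)) {y y₀ : G} {a a₀ t : ℝ}
    (hy : s y = a) (hy₀ : s y₀ = a₀) (ht0 : 0 ≤ t) (ht1 : t ≤ 1) :
    -s (y + t • (y₀ - y)) ≤ ((-a + t * (a - a₀) : ℝ) : EReal) := by
  have h := epi_combo hs.2.2 (x := y) (y := y₀) (a := -a) (b := -a₀) (t := t) (by simp [hy])
    (by simp [hy₀]) ht0 ht1
  convert h using 3
  ring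

theorem exists_segment_value (hs : IsGammaZero (fun y => -s y)) {y y₀ : G} {a a₀ t : ℝ}
    (hy : s y = a) (hy₀ : s y₀ = a₀) (ha : 0 ≤ a) (ha₀ : 0 < a₀) (ht0 : 0 < t) (ht1 : t ≤ 1) :
    ∃ σ : ℝ, s (y + t • (y₀ - y)) = σ ∧ 0 < σ := by
  have h := neg_segment_le hs hy hy₀ ht0.le ht1
  have hb := hs.1.1 (y + t • (y₀ - y))
  induction hσ : s (y + t • (y₀ - y)) with
  | bot => simp [hσ] at h; exact absurd h (EReal.coe_ne_top _)
  | top => simp [hσ] at hb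
  | coe σ =>
    refine ⟨σ, rfl, ?_⟩
    rw [hσ, ← EReal.coe_neg, EReal.coe_le_coe_iff] at h
    nlinarith [mul_pos ht0 ha₀, mul_nonneg (sub_nonneg.2 ht1) ha]

theorem exists_pos_value {α : Type*} {s : α → EReal} (hS : (posSet s).Nonempty) : ∃ y₀, ∃ a₀ : ℝ, s y₀ = a₀ ∧ 0 < a₀ := by
  obtain ⟨y₀, h0, h1⟩ := hS
  have e := EReal.coe_toReal h1.ne (EReal.bot_lt_zero.trans h0).ne'
  refine ⟨y₀, _, e.symm, ?_⟩
  rw [← e] at h0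
  exact_mod_cast h0

theorem coe_toReal_of_nonneg (hs : IsGammaZero (fun y => -s y)) {y : G} (h : 0 ≤ s y) :
    s y = (s y).toReal :=
  (EReal.coe_toReal (fun ht => hs.1.1 y (by simp [ht])) (EReal.bot_lt_zero.trans_le h).ne').symm

theorem tendsto_segment (y y₀ : G) :
    Tendsto (fun t : ℝ => y + t • (y₀ - y)) (𝓝[>] 0) (𝓝 y) := by
  have h := ((by fun_prop : Continuous fun t : ℝ => y + t • (y₀ - y)).tendsto 0).mono_left
    (nhdsWithin_le_nhds (s := Set.Ioi 0))
  rwa [zero_smul, add_zero] at h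

/-- By concavity, a segment from a point of `{s ≥ 0}` towards a point of `S` enters `S` at once. -/
theorem closure_posSet (hs : IsGammaZero (fun y => -s y)) (hS : (posSet s).Nonempty) :
    closure (posSet s) = {y | 0 ≤ s y} := by
  apply Set.Subset.antisymm
  · refine closure_minimal (fun y hy => hy.1.le) ?_
    have : IsClosed {y | -s y ≤ 0} := hs.2.1.isClosed_preimage 0
    simpa only [neg_le_zero_iff_nonneg] using this
  · intro y hy
    obtain ⟨y₀, a₀, hy₀, ha₀⟩ := exists_pos_value hS
    have e := coe_toReal_of_nonneg hs hy
    have ha : 0 ≤ (s y).toReal := EReal.toReal_nonneg hy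
    refine mem_closure_of_tendsto (tendsto_segment y y₀) ?_
    filter_upwards [Ioc_mem_nhdsGT (zero_lt_one (α := ℝ))] with t ht
    obtain ⟨σ, hσ, hσ0⟩ := exists_segment_value hs e hy₀ ha ha₀ ht.1 ht.2
    exact ⟨by rw [hσ]; exact_mod_cast hσ0, by rw [hσ]; exact EReal.coe_lt_top σ⟩

theorem negPart_le_iff {α : Type*} {f : α → EReal} (hf : ∀ y, f y ≠ ⊥) {y : α} {b : ℝ} :
    negPart f y ≤ b ↔ f y ≤ b ∧ f y < 0 := by
  by_cases h : f y < 0 <;> simp [negPart, h, bot_lt_iff_ne_bot.2 (hf y)]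

/-- `negOnNonneg s` equals its biconjugate, so it suffices that it has the same affine minorants as
`negPart` of `-s`. The two differ only where `s = 0`, and such points are reached along segments
inside `S`. -/
theorem negEnv_eq [CompleteSpace G] (hs : IsGammaZero (fun y => -s y))
    (hS : (posSet s).Nonempty) : negEnv s = negOnNonneg s := by
  have hconj : ∀ {y : G} {c : ℝ}, negEnv s y ≤ c ↔
      ∀ (u : G) (b : ℝ), conj (negPart fun y => -s y) u ≤ b → inner ℝ y u - b ≤ c := by
    intro y c
    rw [negEnv, downEnv, conj_le_iff]
    simp_rw [real_inner_comm y]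
    exact forall_congr' fun u => forall_congr' fun b => forall_congr' fun _ =>
      ⟨fun h => by linarith, fun h => by linarith⟩
  have key : ∀ (y : G) (c : ℝ), negEnv s y ≤ c ↔ negOnNonneg s y ≤ c := by
    intro y c
    constructor
    · intro h
      refine (isGammaZero_negOnNonneg hs hS).le_of_conj fun u b hu => hconj.1 h u b ?_
      rw [conj_le_iff] at hu ⊢
      intro z t hz
      rw [negPart_le_iff hs.1.1] at hz
      exact hu z t (negOnNonneg_le_iff.2 ⟨hz.1, neg_le_zero_iff_nonneg.1 hz.2.le⟩)
    · intro h
      rw [negOnNonneg_le_iff] at h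
      obtain ⟨y₀, a₀, hy₀, ha₀⟩ := exists_pos_value hS
      have e := coe_toReal_of_nonneg hs h.2
      have ha : 0 ≤ (s y).toReal := EReal.toReal_nonneg h.2
      set a := (s y).toReal
      have hac : -a ≤ c := by
        have h1 := h.1
        rw [e, ← EReal.coe_neg] at h1
        exact_mod_cast h1
      refine hconj.2 fun u b hu => ?_
      rw [conj_le_iff] at hu
      suffices h' : inner ℝ y u - b ≤ -a from h'.trans hac
      refine le_of_forall_le_add_mul (N := (a - a₀) - inner ℝ (y₀ - y) u) fun t ht0 ht1 => ?_
      obtain ⟨σ, hσ, hσ0⟩ := exists_segment_value hs e hy₀ ha ha₀ ht0 ht1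
      have h1 := hu (y + t • (y₀ - y)) (-a + t * (a - a₀)) ((negPart_le_iff hs.1.1).2
        ⟨neg_segment_le hs e hy₀ ht0.le ht1, by
          rw [hσ, ← EReal.coe_neg]; exact_mod_cast neg_lt_zero.2 hσ0⟩)
      rw [inner_add_left, real_inner_smul_left] at h1
      linarith
  funext y
  refine le_antisymm ?_ ?_
  · exact EReal.le_of_forall_lt_iff_le.1 fun c hc => (key y c).2 hc.le
  · exact EReal.le_of_forall_lt_iff_le.1 fun c hc => (key y c).1 hc.le

theorem dom_negOnNonneg (hs : IsGammaZero (fun y => -s y)) :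
    dom (negOnNonneg s) = {y | 0 ≤ s y} := by
  ext y
  by_cases h : 0 ≤ s y
  · simp [dom, negOnNonneg, h]
    rw [coe_toReal_of_nonneg hs h, ← EReal.coe_neg]
    exact EReal.coe_lt_top _
  · simp [dom, negOnNonneg, h]

end NegEnv

/-! ### Bounds on the perspective and its proximal point. -/

section Perspective

open Filter Topology

variable {H G : Type*} [NormedAddCommGroup H] [InnerProductSpace ℝ H]
  [NormedAddCommGroup G] [InnerProductSpace ℝ G] {φ : H → EReal} {s : G → EReal}

theorem perspective_le_preperspective (z : WithLp 2 (H × G)) :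
    perspective φ s z ≤ preperspective φ s z :=
  (perspective_isGreatest φ s).1.2 z

theorem isLscConvex_affine {E : Type*} [NormedAddCommGroup E] [InnerProductSpace ℝ E] (u : E)
    (κ : ℝ) : IsLscConvex (fun z : E => ((inner ℝ z u - κ : ℝ) : EReal)) := by
  constructor
  · exact (continuous_coe_real_ereal.comp (by fun_prop)).lowerSemicontinuous
  · rintro ⟨x, a⟩ hx ⟨y, b⟩ hy t r ht hr htr
    simp only [epi, Set.mem_ofPred_eq, EReal.coe_le_coe_iff, Prod.smul_mk, Prod.mk_add_mk,
      smul_eq_mul, inner_add_left, real_inner_smul_left] at hx hy ⊢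
    have : κ = t * κ + r * κ := by rw [← add_mul, htr, one_mul]
    linarith [mul_le_mul_of_nonneg_left hx ht, mul_le_mul_of_nonneg_left hy hr]

theorem preperspective_le_iff {K : Type*} {s : K → EReal} {x : H} {y : K} {σ b : ℝ} (hy : s y = σ) (hσ : 0 < σ) :
    preperspective φ s (WithLp.toLp 2 (x, y)) ≤ b ↔ φ (σ⁻¹ • x) ≤ ((b / σ : ℝ) : EReal) := by
  have h : 0 < s y ∧ s y < ⊤ := by
    rw [hy]; exact ⟨by exact_mod_cast hσ, EReal.coe_lt_top σ⟩
  change (if 0 < s y ∧ s y < ⊤ then s y * φ ((s y).toReal⁻¹ • x) else ⊤) ≤ _ ↔ _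
  rw [if_pos h, hy, EReal.toReal_coe]
  exact coe_mul_le_iff hσ

/-- An affine function whose slope `u` satisfies a Fenchel–Young type inequality minorizes the
perspective. -/
theorem affine_le_perspective {u : H} {w : G} {c κ : ℝ} (hu : conj φ u ≤ c)
    (hw : ∀ (y : G) (σ : ℝ), s y = σ → 0 < σ → inner ℝ y w + σ * c ≤ κ)
    (z : WithLp 2 (H × G)) :
    ((inner ℝ z (WithLp.toLp 2 (u, w)) - κ : ℝ) : EReal) ≤ perspective φ s z := by
  refine (perspective_isGreatest φ s).2 ⟨isLscConvex_affine _ _, fun z => ?_⟩ z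
  by_cases h : 0 < s z.snd ∧ s z.snd < ⊤
  swap
  · rw [preperspective, if_neg h]; exact le_top
  have e := EReal.coe_toReal h.2.ne (EReal.bot_lt_zero.trans h.1).ne'
  set σ := (s z.snd).toReal
  have hσ : 0 < σ := by have := h.1; rw [← e] at this; exact_mod_cast this
  refine EReal.le_of_forall_lt_iff_le.1 fun b hb => ?_
  have h1 := (preperspective_le_iff (x := z.fst) e.symm hσ).1 hb.le
  have h2 := conj_le_iff.1 hu _ _ h1
  rw [real_inner_smul_left, le_div_iff₀ hσ, sub_mul, mul_right_comm, inv_mul_cancel₀ hσ.ne',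
    one_mul] at h2
  rw [EReal.coe_le_coe_iff, WithLp.prod_inner_apply]
  have h3 := hw _ _ e.symm hσ
  change inner ℝ z.fst u + inner ℝ z.snd w - κ ≤ b
  linarith

/-- By `hq`, `q` maximizes `⟪X, u⟫ - η φ^*(u)`; Fenchel–Moreau turns this into a bound on `η
φ(X/η)`. -/
theorem perspective_le_of_pos [CompleteSpace H] (hφ : IsGammaZero φ) {q X : H} {r : G}
    {η c : ℝ} (hη : 0 < η) (hr : s r = η)
    (hq : ∀ (u : H) (b : ℝ), conj φ u ≤ b → inner ℝ (u - q) X ≤ η * (b - c)) :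
    perspective φ s (WithLp.toLp 2 (X, r)) ≤ ((inner ℝ X q - η * c : ℝ) : EReal) := by
  refine (perspective_le_preperspective _).trans ((preperspective_le_iff hr hη).2 ?_)
  refine hφ.le_of_conj fun u b hu => ?_
  have h := hq u b hu
  rw [inner_sub_left, real_inner_comm, real_inner_comm X q] at h
  rw [real_inner_smul_left, le_div_iff₀ hη, sub_mul, mul_right_comm, inv_mul_cancel₀ hη.ne',
    one_mul]
  linarith

/-- The preperspective is `+∞` at such a point, so the bound is a limit. Move `r` towards a point of
`S`, let `σ > 0` be the value of `s` there, and shift `X` by `σ x₁` with `x₁ ∈ dom φ`. The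
preperspective is then at most `σ φ(x₁) + ⟪X, q⟫`, and `σ → 0` since `-s` is lower semicontinuous.
-/
theorem perspective_le_of_zero [CompleteSpace H] (hφ : IsGammaZero φ)
    (hs : IsGammaZero (fun y => -s y)) (hS : (posSet s).Nonempty) {q X : H} {r : G}
    (hr : s r = 0) (hq : ∀ (u : H) (b : ℝ), conj φ u ≤ b → inner ℝ (u - q) X ≤ 0) :
    perspective φ s (WithLp.toLp 2 (X, r)) ≤ ((inner ℝ X q : ℝ) : EReal) := by
  obtain ⟨y₀, a₀, hy₀, ha₀⟩ := exists_pos_value hS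
  obtain ⟨x₁, α, hα⟩ := hφ.exists_le
  have hseg : ∀ t : ℝ, t ∈ Set.Ioc (0 : ℝ) 1 →
      s (r + t • (y₀ - r)) = (s (r + t • (y₀ - r))).toReal ∧
        0 < (s (r + t • (y₀ - r))).toReal := fun t ht => by
    obtain ⟨σ, hσ, hσ0⟩ := exists_segment_value hs (a := 0) hr hy₀ le_rfl ha₀ ht.1 ht.2
    rw [hσ, EReal.toReal_coe]
    exact ⟨rfl, hσ0⟩
  have hev := Ioc_mem_nhdsGT (zero_lt_one (α := ℝ))
  have hσ : Tendsto (fun t : ℝ => (s (r + t • (y₀ - r))).toReal) (𝓝[>] 0) (𝓝 0) := by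
    refine tendsto_order.2 ⟨fun a ha => ?_, fun ε hε => ?_⟩
    · filter_upwards [hev] with t ht using ha.trans (hseg t ht).2
    · have hlt : ((-ε : ℝ) : EReal) < -s r := by rw [hr]; simpa using hε
      filter_upwards [hev, (tendsto_segment r y₀).eventually (hs.2.1 _ _ hlt)] with t ht ht'
      rw [(hseg t ht).1, ← EReal.coe_neg] at ht'
      linarith [EReal.coe_lt_coe_iff.1 ht']
  have hcl := (perspective_isGreatest φ s).1.1.isClosed_epi
  have hlim : Tendsto (fun t : ℝ => (WithLp.toLp 2 (X + (s (r + t • (y₀ - r))).toReal • x₁,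
      r + t • (y₀ - r)), (s (r + t • (y₀ - r))).toReal * α + inner ℝ X q)) (𝓝[>] 0)
      (𝓝 (WithLp.toLp 2 (X + (0 : ℝ) • x₁, r), 0 * α + inner ℝ X q)) :=
    (((WithLp.prod_continuous_toLp 2 H G).tendsto _).comp
      (((hσ.smul_const x₁).const_add X).prodMk_nhds (tendsto_segment r y₀))).prodMk_nhds
      ((hσ.mul_const α).add_const _)
  rw [zero_smul, add_zero, zero_mul, zero_add] at hlim
  refine hcl.mem_of_tendsto hlim ?_
  filter_upwards [hev] with t ht
  obtain ⟨e, hpos⟩ := hseg t ht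
  set σ := (s (r + t • (y₀ - r))).toReal
  refine (perspective_le_preperspective _).trans ((preperspective_le_iff e hpos).2 ?_)
  refine hφ.le_of_conj fun u b hu => ?_
  have h1 := hq u b hu
  have h2 := conj_le_iff.1 hu x₁ α hα.le
  rw [inner_sub_left, real_inner_comm, real_inner_comm X q] at h1
  rw [smul_add, inv_smul_smul₀ hpos.ne', inner_add_left, real_inner_smul_left,
    le_div_iff₀ hpos, sub_mul, add_mul, mul_right_comm, inv_mul_cancel₀ hpos.ne', one_mul]
  nlinarith

/-- A pair of variational inequalities coupled by `s r = η` yields the proximal point of the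
perspective. -/
theorem isProx_perspective [CompleteSpace H] (hφ : IsGammaZero φ)
    (hs : IsGammaZero (fun y => -s y)) (hS : (posSet s).Nonempty) {γ : ℝ} (hγ : 0 < γ)
    {x q : H} {y r : G} {η c : ℝ} (hη : 0 ≤ η) (hr : s r = η) (hc : conj φ q = c)
    (hq : ∀ (u : H) (b : ℝ), conj φ u ≤ b → inner ℝ (u - q) (x - γ • q) ≤ η * (b - c))
    (hy : ∀ (v : G) (σ : ℝ), s v = σ → 0 < σ → inner ℝ (v - r) (y - r) ≤ γ * c * (η - σ)) :
    IsProx (scale γ (perspective φ s)) (WithLp.toLp 2 (x, y))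
      (WithLp.toLp 2 (x - γ • q, r)) := by
  set X := x - γ • q with hX
  set z : WithLp 2 (H × G) := WithLp.toLp 2 (X, r) with hz
  -- `Q = ((x, y) - z)/γ` is the candidate subgradient at `z`: the affine minorant of slope `Q` in
  -- `hlow` meets the upper bound `hup` at `z`.
  set Q : WithLp 2 (H × G) := WithLp.toLp 2 (q, γ⁻¹ • (y - r)) with hQ
  have hup : perspective φ s z ≤ ((inner ℝ X q - η * c : ℝ) : EReal) := by
    rcases hη.eq_or_lt with rfl | hη
    · rw [zero_mul, sub_zero]
      exact perspective_le_of_zero hφ hs hS hr fun u b hu => by simpa using hq u b hu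
    · exact perspective_le_of_pos hφ hη hr hq
  have hlow : ∀ z', ((inner ℝ z' Q - (inner ℝ r (γ⁻¹ • (y - r)) + η * c) : ℝ) : EReal) ≤
      perspective φ s z' := by
    refine affine_le_perspective hc.le fun v σ hv hσ => ?_
    have h := hy v σ hv hσ
    rw [inner_sub_left] at h
    rw [inner_smul_right, inner_smul_right]
    have h' := mul_le_mul_of_nonneg_left h (inv_pos.2 hγ).le
    have e : γ⁻¹ * (γ * c * (η - σ)) = c * (η - σ) := by field_simp
    rw [e] at h'
    linarith
  refine isProx_of_variational (a := γ * (inner ℝ X q - η * c)) ?_ fun z' b hb => ?_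
  · rw [scale, coe_mul_le_iff hγ, mul_div_cancel_left₀ _ hγ.ne']
    exact hup
  · rw [scale, coe_mul_le_iff hγ] at hb
    have h1 := (hlow z').trans hb
    rw [EReal.coe_le_coe_iff, le_div_iff₀ hγ] at h1
    have e : WithLp.toLp 2 (x, y) - z = γ • Q := by
      rw [hz, hQ, ← WithLp.toLp_sub, ← WithLp.toLp_smul, Prod.mk_sub_mk, Prod.smul_mk,
        smul_inv_smul₀ hγ.ne', hX, sub_sub_cancel]
    rw [e, inner_smul_right, inner_sub_left]
    have e2 : inner ℝ z Q = inner ℝ X q + inner ℝ r (γ⁻¹ • (y - r)) := by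
      rw [hz, hQ, WithLp.prod_inner_apply]
    rw [e2]
    linarith

end Perspective

/-! ### The scalar equation for `η`: existence and uniqueness. -/

section FixedPoint

theorem exists_fixed_point_of_le {T : ℝ → ℝ} {a : ℝ} (hT : ContinuousOn T (Set.Ici a))
    (hanti : ∀ t, a ≤ t → T t ≤ T a) (ha : a ≤ T a) : ∃ η, a ≤ η ∧ T η = η := by
  have hc : ContinuousOn (fun t => t - T t) (Set.Icc a (T a)) :=
    continuousOn_id.sub (hT.mono Set.Icc_subset_Ici_self)
  obtain ⟨η, hη, h⟩ := intermediate_value_Icc ha hc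
    (show (0 : ℝ) ∈ Set.Icc _ _ from ⟨by linarith, by linarith [hanti _ ha]⟩)
  exact ⟨η, hη.1, by simp only at h; linarith⟩

variable {G : Type*} [NormedAddCommGroup G] [InnerProductSpace ℝ G] {s : G → EReal}

theorem negOnNonneg_add_eq_zero (hs : IsGammaZero (fun y => -s y)) {r : G} {η : ℝ} (hη : 0 ≤ η) :
    negOnNonneg s r + (η : EReal) = 0 ↔ s r = η := by
  by_cases h : 0 ≤ s r
  · rw [negOnNonneg, if_pos h, coe_toReal_of_nonneg hs h, ← EReal.coe_neg, ← EReal.coe_add,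
      EReal.coe_eq_zero, EReal.coe_eq_coe_iff]
    constructor <;> intro h <;> linarith
  · rw [negOnNonneg, if_neg h, EReal.top_add_coe]
    refine ⟨fun h => absurd h EReal.top_ne_zero, fun h' => absurd ?_ h⟩
    rw [h']; exact_mod_cast hη

theorem closure_dom_negOnNonneg (hs : IsGammaZero (fun y => -s y)) (hS : (posSet s).Nonempty) :
    closure (dom (negOnNonneg s)) = closure (posSet s) := by
  rw [dom_negOnNonneg hs, ← closure_posSet hs hS, closure_closure]

variable [CompleteSpace G]

theorem nonneg_prox_negOnNonneg (hs : IsGammaZero (fun y => -s y)) (hS : (posSet s).Nonempty)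
    (y : G) {c : ℝ} (hc : 0 ≤ c) : 0 ≤ s (prox (odot c (negOnNonneg s)) y) := by
  have hg := isGammaZero_negOnNonneg hs hS
  rcases hc.eq_or_lt with rfl | hc
  · have h := hg.proj_mem y
    rwa [closure_dom_negOnNonneg hs hS, closure_posSet hs hS] at h
  · have h : _ ∈ dom (negOnNonneg s) := hg.prox_odot_lt_top hc y
    rwa [dom_negOnNonneg hs] at h

theorem prox_negOnNonneg_lt_top (hs : IsGammaZero (fun y => -s y)) (hS : (posSet s).Nonempty)
    (y : G) {c : ℝ} (hc : 0 ≤ c) :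
    negOnNonneg s (prox (odot c (negOnNonneg s)) y) < ⊤ := by
  have h := nonneg_prox_negOnNonneg hs hS y hc
  rwa [← Set.mem_ofPred_eq (p := fun y => 0 ≤ s y), ← dom_negOnNonneg hs] at h

theorem apply_prox_negOnNonneg (hs : IsGammaZero (fun y => -s y)) (hS : (posSet s).Nonempty)
    (y : G) {c : ℝ} (hc : 0 ≤ c) :
    s (prox (odot c (negOnNonneg s)) y) = ((-proxValue (negOnNonneg s) y c : ℝ) : EReal) := by
  have h := nonneg_prox_negOnNonneg hs hS y hc
  obtain ⟨a, ha⟩ : ∃ a : ℝ, s (prox (odot c (negOnNonneg s)) y) = a :=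
    ⟨_, coe_toReal_of_nonneg hs h⟩
  rw [proxValue, negOnNonneg, if_pos h, ha, ← EReal.coe_neg, EReal.toReal_coe, neg_neg]

theorem proxValue_negOnNonneg_nonpos (hs : IsGammaZero (fun y => -s y))
    (hS : (posSet s).Nonempty) (y : G) {c : ℝ} (hc : 0 ≤ c) :
    proxValue (negOnNonneg s) y c ≤ 0 := by
  have h := nonneg_prox_negOnNonneg hs hS y hc
  rw [apply_prox_negOnNonneg hs hS y hc] at h
  have : 0 ≤ -proxValue (negOnNonneg s) y c := by exact_mod_cast h
  linarith

/-- A large coefficient `c` forces `s ≥ a/2` at the proximal point. Testing at `y₀` and completing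
the square gives `c (a + proxValue) ≤ ‖y₀ - y‖² / 4`, which is at most `c a / 2`. -/
theorem proxValue_negOnNonneg_le (hs : IsGammaZero (fun y => -s y)) (hS : (posSet s).Nonempty)
    {y y₀ : G} {a c : ℝ} (hy₀ : s y₀ = a) (ha : 0 < a) (hc : 0 < c)
    (hca : ‖y₀ - y‖ ^ 2 ≤ 2 * a * c) : proxValue (negOnNonneg s) y c ≤ -(a / 2) := by
  have hg := isGammaZero_negOnNonneg hs hS
  have h := hg.prox_odot_variational hc.le y (hg.coe_proxValue (hg.prox_odot_lt_top hc y))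
    (z := y₀) (b := -a) (negOnNonneg_le_iff.2 ⟨by rw [hy₀, EReal.coe_neg], by
      rw [hy₀]; exact_mod_cast ha.le⟩)
  set p := prox (odot c (negOnNonneg s)) y
  have e : inner ℝ (y₀ - p) (y - p) = inner ℝ (y₀ - y) (y - p) + ‖y - p‖ ^ 2 := by
    rw [← real_inner_self_eq_norm_sq, ← inner_add_left]; congr 1; abel
  have h1 := abs_le.1 (abs_real_inner_le_norm (y₀ - y) (y - p))
  have h2 : c * (a / 2) ≤ c * -(proxValue (negOnNonneg s) y c) := by
    nlinarith [sq_nonneg (‖y₀ - y‖ - 2 * ‖y - p‖)]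
  linarith [le_of_mul_le_mul_left h2 hc]

variable {H : Type*} [NormedAddCommGroup H] [InnerProductSpace ℝ H] {φ : H → EReal} {γ : ℝ}

theorem proxValue_nonneg {E : Type*} [NormedAddCommGroup E] {f : E → EReal} (hf : ∀ u, 0 ≤ f u) (x : E) (t : ℝ) :
    0 ≤ proxValue f x t :=
  EReal.toReal_nonneg (hf _)

theorem solvesMain_iff (hs : IsGammaZero (fun y => -s y)) (hS : (posSet s).Nonempty) {x : H}
    {y : G} {η : ℝ} (hη : 0 ≤ η) :
    SolvesMain φ s γ x y η ↔ conj φ (prox (odot (η / γ) (conj φ)) (γ⁻¹ • x)) < ⊤ ∧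
      s (prox (odot (γ * proxValue (conj φ) (γ⁻¹ • x) (η / γ)) (negOnNonneg s)) y) = η := by
  rw [SolvesMain, negEnv_eq hs hS, negOnNonneg_add_eq_zero hs hη]
  rfl

variable [CompleteSpace H]

theorem exists_solvesMain (hφ : IsGammaZero φ) (hφ0 : ∀ u, 0 ≤ conj φ u)
    (hs : IsGammaZero (fun y => -s y)) (hS : (posSet s).Nonempty) (hγ : 0 < γ) (x : H) (y : G) :
    ∃ η : ℝ, 0 ≤ η ∧ SolvesMain φ s γ x y η := by
  have hf := hφ.conj
  have hg := isGammaZero_negOnNonneg hs hS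
  set X := γ⁻¹ • x
  set F := proxValue (conj φ) X with hF
  have hF0 : ∀ t, 0 ≤ γ * F t := fun t => mul_nonneg hγ.le (proxValue_nonneg hφ0 X t)
  set T : ℝ → ℝ := fun η => -proxValue (negOnNonneg s) y (γ * F (η / γ)) with hT
  have hgfin := fun {c : ℝ} (hc : 0 ≤ c) => prox_negOnNonneg_lt_top hs hS y hc
  suffices h : ∃ η : ℝ, 0 ≤ η ∧ conj φ (prox (odot (η / γ) (conj φ)) X) < ⊤ ∧ T η = η by
    obtain ⟨η, hη, h1, h2⟩ := h
    refine ⟨η, hη, (solvesMain_iff hs hS hη).2 ⟨h1, ?_⟩⟩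
    rw [apply_prox_negOnNonneg hs hS y (hF0 _)]
    exact congrArg _ h2
  have hcont : ∀ a : ℝ, ContinuousOn F (Set.Ici (a / γ)) → ContinuousOn T (Set.Ici a) := by
    intro a ha
    refine ContinuousOn.neg ((hg.continuousOn_proxValue (hgfin le_rfl)).comp
      (continuousOn_const.mul (ha.comp (by fun_prop) fun η hη => ?_)) fun η _ => hF0 _)
    exact div_le_div_of_nonneg_right hη hγ.le
  have hanti : ∀ a t : ℝ, 0 ≤ a → a ≤ t → conj φ (prox (odot (a / γ) (conj φ)) X) < ⊤ →
      T t ≤ T a := by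
    intro a t ha hat hfin
    have h1 := hf.proxValue_anti (div_nonneg ha hγ.le) (div_le_div_of_nonneg_right hat hγ.le) hfin
    exact neg_le_neg (hg.proxValue_anti (hF0 _) (mul_le_mul_of_nonneg_left h1 hγ.le)
      (hgfin (hF0 _)))
  have hT0 : ∀ η, 0 ≤ T η := fun η =>
    neg_nonneg.2 (proxValue_negOnNonneg_nonpos hs hS y (hF0 _))
  have hpos : ∀ {η : ℝ}, 0 < η → conj φ (prox (odot (η / γ) (conj φ)) X) < ⊤ := fun hη =>
    hf.prox_odot_lt_top (div_pos hη hγ) X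
  by_cases h0 : conj φ (prox (odot 0 (conj φ)) X) < ⊤
  · have h0' : conj φ (prox (odot (0 / γ) (conj φ)) X) < ⊤ := by rwa [zero_div]
    obtain ⟨η, hη, h⟩ := exists_fixed_point_of_le
      (hcont 0 (by rw [zero_div]; exact hf.continuousOn_proxValue h0))
      (fun t ht => hanti 0 t le_rfl ht h0') (hT0 0)
    refine ⟨η, hη, ?_, h⟩
    rcases hη.eq_or_lt with rfl | hη
    exacts [h0', hpos hη]
  · obtain ⟨y₀, a, hy₀, ha⟩ := exists_pos_value hS
    obtain ⟨t, ht, hFt⟩ := hf.exists_lt_proxValue (not_lt_top_iff.1 h0)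
      (‖y₀ - y‖ ^ 2 / (2 * a) / γ)
    rw [div_lt_iff₀ hγ, div_lt_iff₀ (by positivity)] at hFt
    -- The bound `γ t` keeps `F (ε/γ)` at least `F t`, large enough to give `T ε ≥ a/2`; the bound
    -- `a/2` then gives `ε ≤ T ε`.
    have hε : 0 < min (γ * t) (a / 2) := by positivity
    set ε := min (γ * t) (a / 2)
    have hεt : ε / γ ≤ t := by
      rw [div_le_iff₀ hγ, mul_comm]; exact min_le_left _ _
    have h1 : F t ≤ F (ε / γ) := hf.proxValue_anti (by positivity) hεt (hpos hε)
    have h2 : ‖y₀ - y‖ ^ 2 < 2 * a * (γ * F (ε / γ)) := by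
      have := mul_le_mul_of_nonneg_left h1 (show 0 ≤ 2 * a * γ by positivity)
      linarith
    have h3 : 0 < γ * F (ε / γ) :=
      pos_of_mul_pos_right ((sq_nonneg _).trans_lt h2) (by positivity)
    have h4 : ε ≤ T ε := by
      have := proxValue_negOnNonneg_le hs hS hy₀ ha h3 h2.le
      linarith [min_le_right (γ * t) (a / 2)]
    obtain ⟨η, hη, h⟩ := exists_fixed_point_of_le
      (hcont ε fun t ht => (hf.continuousAt_proxValue X
        ((div_pos hε hγ).trans_le ht)).continuousWithinAt)
      (fun t ht => hanti ε t hε.le ht (hpos hε)) h4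
    exact ⟨η, hε.le.trans hη, hpos (hε.trans_le hη), h⟩

theorem SolvesMain.isProx (hφ : IsGammaZero φ) (hφ0 : ∀ u, 0 ≤ conj φ u)
    (hs : IsGammaZero (fun y => -s y)) (hS : (posSet s).Nonempty) (hγ : 0 < γ) {x : H} {y : G}
    {η : ℝ} (hη : 0 ≤ η) (h : SolvesMain φ s γ x y η) :
    IsProx (scale γ (perspective φ s)) (WithLp.toLp 2 (x, y))
      (WithLp.toLp 2 (x - γ • prox (odot (η / γ) (conj φ)) (γ⁻¹ • x),
        prox (odot (γ * proxValue (conj φ) (γ⁻¹ • x) (η / γ)) (negOnNonneg s)) y)) := by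
  obtain ⟨h1, h2⟩ := (solvesMain_iff hs hS hη).1 h
  have hf := hφ.conj
  have hg := isGammaZero_negOnNonneg hs hS
  have hc := hf.coe_proxValue h1
  have hc0 : 0 ≤ γ * proxValue (conj φ) (γ⁻¹ • x) (η / γ) :=
    mul_nonneg hγ.le (proxValue_nonneg hφ0 _ _)
  refine isProx_perspective hφ hs hS hγ hη h2 hc (fun u b hu => ?_) fun v σ hv hσ => ?_
  · have h3 := hf.prox_odot_variational (div_nonneg hη hγ.le) _ hc hu
    set q := prox (odot (η / γ) (conj φ)) (γ⁻¹ • x)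
    have e : x - γ • q = γ • (γ⁻¹ • x - q) := by rw [smul_sub, smul_inv_smul₀ hγ.ne']
    rw [e, inner_smul_right]
    have h4 := mul_le_mul_of_nonneg_left h3 hγ.le
    rwa [← mul_assoc, mul_div_cancel₀ _ hγ.ne'] at h4
  · have hr : negOnNonneg s (prox (odot (γ * proxValue (conj φ) (γ⁻¹ • x) (η / γ))
        (negOnNonneg s)) y) = ((-η : ℝ) : EReal) := by
      rw [negOnNonneg, if_pos (by rw [h2]; exact_mod_cast hη), h2, EReal.coe_neg]
    have h3 := hg.prox_odot_variational hc0 y hr (z := v) (b := -σ)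
      (negOnNonneg_le_iff.2 ⟨by rw [hv, EReal.coe_neg], by rw [hv]; exact_mod_cast hσ.le⟩)
    rwa [neg_sub_neg] at h3

/-- Both solutions produce the same proximal point of the perspective, and each is the value of `s`
at its second component. -/
theorem SolvesMain.unique (hφ : IsGammaZero φ) (hφ0 : ∀ u, 0 ≤ conj φ u)
    (hs : IsGammaZero (fun y => -s y)) (hS : (posSet s).Nonempty) (hγ : 0 < γ) {x : H} {y : G}
    {η ξ : ℝ} (hη : 0 ≤ η) (hξ : 0 ≤ ξ) (h : SolvesMain φ s γ x y η)
    (h' : SolvesMain φ s γ x y ξ) : η = ξ := by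
  have e := (h.isProx hφ hφ0 hs hS hγ hη).prox_eq.symm.trans
    (h'.isProx hφ hφ0 hs hS hγ hξ).prox_eq
  have e2 := congrArg (fun z : WithLp 2 (H × G) => s z.snd) e
  simp only [WithLp.toLp_snd] at e2
  rw [((solvesMain_iff hs hS hη).1 h).2, ((solvesMain_iff hs hS hξ).1 h').2] at e2
  exact_mod_cast e2

end FixedPoint

/-! ### The four regions and the solution on each. -/

section Partition

theorem prox_scale_of_pos {E : Type*} [NormedAddCommGroup E] {c : ℝ} (hc : 0 < c) (f : E → EReal) (x : E) :
    prox (scale c f) x = prox (odot c f) x := by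
  rw [odot, if_neg hc.ne']

theorem proj_closure_dom {E : Type*} [NormedAddCommGroup E] (f : E → EReal) (x : E) :
    proj (closure (dom f)) x = prox (odot 0 f) x := by
  rw [proj, odot, if_pos rfl]

variable {H G : Type*} [NormedAddCommGroup H] [InnerProductSpace ℝ H]
  [NormedAddCommGroup G] [InnerProductSpace ℝ G]
  {φ : H → EReal} {s : G → EReal} {γ : ℝ} {x : H} {y : G}

theorem existsUnique_fin_four {p : Fin 4 → Prop} (h01 : p 0 → ¬p 1) (h02 : p 0 → ¬p 2)
    (h12 : p 1 → ¬p 2) (h3 : p 3 ↔ ¬(p 0 ∨ p 1 ∨ p 2)) : ∃! i, p i := by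
  by_cases h0 : p 0
  · exact ⟨0, h0, fun j hj => by fin_cases j <;> simp_all⟩
  by_cases h1 : p 1
  · exact ⟨1, h1, fun j hj => by fin_cases j <;> simp_all⟩
  by_cases h2 : p 2
  · exact ⟨2, h2, fun j hj => by fin_cases j <;> simp_all⟩
  · exact ⟨3, by simp_all, fun j hj => by fin_cases j <;> simp_all⟩

theorem proj_closure_posSet (hs : IsGammaZero (fun y => -s y)) (hS : (posSet s).Nonempty)
    (y : G) : proj (closure (posSet s)) y = prox (odot 0 (negOnNonneg s)) y := by
  rw [← proj_closure_dom, closure_dom_negOnNonneg hs hS]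

variable [CompleteSpace G]

theorem solvesMain_of_mem_Omega1 (hs : IsGammaZero (fun y => -s y)) (hS : (posSet s).Nonempty)
    (h : (x, y) ∈ Omega1 φ s γ) : SolvesMain φ s γ x y 0 := by
  obtain ⟨h1, h2⟩ := h
  simp only [proj_closure_dom, proj_closure_posSet hs hS] at h1 h2
  rw [solvesMain_iff hs hS le_rfl, zero_div, proxValue, h1, EReal.toReal_zero, mul_zero]
  exact ⟨EReal.zero_lt_top, h2⟩

theorem solvesMain_of_mem_Omega2 (hs : IsGammaZero (fun y => -s y)) (hS : (posSet s).Nonempty)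
    (hγ : 0 < γ) (h : (x, y) ∈ Omega2 φ s γ) : SolvesMain φ s γ x y 0 := by
  obtain ⟨h1, h2, h3⟩ := h
  simp only [proj_closure_dom, negEnv_eq hs hS] at h1 h2 h3
  rw [prox_scale_of_pos (mul_pos hγ (EReal.toReal_pos h1 h2.ne))] at h3
  rw [solvesMain_iff hs hS le_rfl, zero_div]
  exact ⟨h2, h3⟩

theorem solvesMain_of_mem_Omega3 (hs : IsGammaZero (fun y => -s y)) (hS : (posSet s).Nonempty)
    (hγ : 0 < γ) (h : (x, y) ∈ Omega3 φ s γ) :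
    0 < (s (proj (closure (posSet s)) y)).toReal ∧
      SolvesMain φ s γ x y (s (proj (closure (posSet s)) y)).toReal := by
  obtain ⟨h1, h2, h3⟩ := h
  simp only at h1 h2 h3
  have hpos := EReal.toReal_pos h2 h3.ne
  refine ⟨hpos, ?_⟩
  rw [prox_scale_of_pos (div_pos hpos hγ)] at h1
  rw [solvesMain_iff hs hS hpos.le, proxValue, h1, EReal.toReal_zero, mul_zero,
    ← proj_closure_posSet hs hS]
  exact ⟨EReal.zero_lt_top, (EReal.coe_toReal h3.ne (EReal.bot_lt_zero.trans h2).ne').symm⟩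

/-- On `Ω₄` the solution of the main equation and the coefficient of the second prox are positive. -/
theorem SolvesMain.pos_of_mem_Omega4 (hφ0 : ∀ u, 0 ≤ conj φ u)
    (hs : IsGammaZero (fun y => -s y)) (hS : (posSet s).Nonempty) (hγ : 0 < γ) {η : ℝ}
    (hη : 0 ≤ η) (h : SolvesMain φ s γ x y η) (hΩ : (x, y) ∈ Omega4 φ s γ) :
    0 < η ∧ 0 < conj φ (prox (odot (η / γ) (conj φ)) (γ⁻¹ • x)) := by
  obtain ⟨h1, h2⟩ := (solvesMain_iff hs hS hη).1 h
  have hΩ' : ¬(((x, y) ∈ Omega1 φ s γ ∨ (x, y) ∈ Omega2 φ s γ) ∨ (x, y) ∈ Omega3 φ s γ) := hΩ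
  have hη0 : 0 < η := by
    refine lt_of_le_of_ne hη ?_
    rintro rfl
    rw [zero_div] at h1 h2
    -- The solution `η = 0` would put `(x, y)` in `Ω₁` or `Ω₂`, according to whether `φ^*` vanishes
    -- at the projection.
    rcases (hφ0 (prox (odot 0 (conj φ)) (γ⁻¹ • x))).eq_or_lt with h0 | h0
    · refine hΩ' (.inl (.inl ⟨?_, ?_⟩))
      · simp only [proj_closure_dom]; exact h0.symm
      · rw [proxValue, ← h0, EReal.toReal_zero, mul_zero] at h2
        simp only [proj_closure_posSet hs hS]; exact h2
    · refine hΩ' (.inl (.inr ⟨?_, ?_, ?_⟩)) <;> simp only [proj_closure_dom, negEnv_eq hs hS]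
      exacts [h0, h1, by rw [prox_scale_of_pos (mul_pos hγ (EReal.toReal_pos h0 h1.ne))]; exact h2]
  refine ⟨hη0, lt_of_le_of_ne (hφ0 _) fun h0 => ?_⟩
  -- With a zero coefficient the second prox is the projection onto the closure of `S`, so `η` is
  -- the value of `s` there and `(x, y)` would lie in `Ω₃`.
  rw [proxValue, ← h0, EReal.toReal_zero, mul_zero, ← proj_closure_posSet hs hS] at h2
  refine hΩ' (.inr ⟨?_, ?_, ?_⟩) <;> simp only [h2]
  · rw [EReal.toReal_coe, prox_scale_of_pos (div_pos hη0 hγ)]; exact h0.symm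
  · exact_mod_cast hη0
  · exact EReal.coe_lt_top η

variable [CompleteSpace H]

theorem existsUnique_mem_Omega (hφ : IsGammaZero φ) (hφ0 : ∀ u, 0 ≤ conj φ u)
    (hs : IsGammaZero (fun y => -s y)) (hS : (posSet s).Nonempty) (hγ : 0 < γ) (w : H × G) :
    ∃! i : Fin 4, w ∈
      (![Omega1 φ s γ, Omega2 φ s γ, Omega3 φ s γ, Omega4 φ s γ] : Fin 4 → Set (H × G)) i := by
  refine existsUnique_fin_four ?_ ?_ ?_ ?_
  · exact fun h h' => h'.1.ne' h.1
  · exact fun h h' => h'.2.1.ne' h.2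
  -- The only overlap not excluded by the definitions: it would give both a zero and a positive
  -- solution of the main equation.
  · intro h h'
    have h3 := solvesMain_of_mem_Omega3 hs hS hγ h'
    exact h3.1.ne ((solvesMain_of_mem_Omega2 hs hS hγ h).unique hφ hφ0 hs hS hγ le_rfl h3.1.le h3.2)
  · change w ∈ (Omega1 φ s γ ∪ Omega2 φ s γ ∪ Omega3 φ s γ)ᶜ ↔
      ¬(w ∈ Omega1 φ s γ ∨ w ∈ Omega2 φ s γ ∨ w ∈ Omega3 φ s γ)
    simp only [Set.mem_compl_iff, Set.mem_union, or_assoc]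

end Partition

end NLPersp

theorem proposition4p2 {H G : Type*}
    [NormedAddCommGroup H] [InnerProductSpace ℝ H] [CompleteSpace H]
    [NormedAddCommGroup G] [InnerProductSpace ℝ G] [CompleteSpace G]
    (φ : H → EReal) (s : G → EReal)
    (hφ : IsGammaZero φ)
    (hφ_nonneg : ∀ u : H, 0 ≤ conj φ u)
    (hφ_pos : ∃ u : H, 0 < conj φ u ∧ conj φ u < ⊤)
    (hs : IsGammaZero (fun y => -s y))
    (hS : (posSet s).Nonempty)
    (γ : ℝ) (hγ : 0 < γ) :
    -- the four sets form a partition of the product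
    (∀ w : H × G, ∃! i : Fin 4,
      w ∈ (![Omega1 φ s γ, Omega2 φ s γ, Omega3 φ s γ, Omega4 φ s γ] : Fin 4 → Set (H × G)) i) ∧
    ∀ (x : H) (y : G),
      -- the proximity operator of the perspective is well defined at `(x, y)`
      (∃ z, IsProx (scale γ (perspective φ s)) (WithLp.toLp 2 (x, y)) z) ∧
      -- `η` is the unique solution in `[0, +∞)` of the main equation
      ∃ η : ℝ, (0 ≤ η ∧ SolvesMain φ s γ x y η) ∧
        (∀ η' : ℝ, 0 ≤ η' → SolvesMain φ s γ x y η' → η' = η) ∧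
        -- exactly one of the following four properties holds
        ∃! i : Fin 4, (![
          (x, y) ∈ Omega1 φ s γ ∧ η = 0 ∧
            prox (scale γ (perspective φ s)) (WithLp.toLp 2 (x, y)) =
              WithLp.toLp 2
                (x - γ • proj (closure (dom (conj φ))) (γ⁻¹ • x),
                  proj (closure (posSet s)) y),
          (x, y) ∈ Omega2 φ s γ ∧ η = 0 ∧
            prox (scale γ (perspective φ s)) (WithLp.toLp 2 (x, y)) =
              WithLp.toLp 2
                (x - γ • proj (closure (dom (conj φ))) (γ⁻¹ • x),
                  prox (scale
                    (γ * (conj φ (proj (closure (dom (conj φ))) (γ⁻¹ • x))).toReal)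
                    (negEnv s)) y),
          (x, y) ∈ Omega3 φ s γ ∧
            (η : EReal) = s (proj (closure (posSet s)) y) ∧ 0 < η ∧
            prox (scale γ (perspective φ s)) (WithLp.toLp 2 (x, y)) =
              WithLp.toLp 2
                (x - γ • prox (scale ((s (proj (closure (posSet s)) y)).toReal / γ) (conj φ))
                    (γ⁻¹ • x),
                  proj (closure (posSet s)) y),
          (x, y) ∈ Omega4 φ s γ ∧ 0 < η ∧
            -- the coefficient of `(-s)^▼` below is a positive real number
            0 < conj φ (prox (scale (η / γ) (conj φ)) (γ⁻¹ • x)) ∧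
            conj φ (prox (scale (η / γ) (conj φ)) (γ⁻¹ • x)) < ⊤ ∧
            (η : EReal) =
              s (prox (scale
                (γ * (conj φ (prox (scale (η / γ) (conj φ)) (γ⁻¹ • x))).toReal)
                (negEnv s)) y) ∧
            prox (scale γ (perspective φ s)) (WithLp.toLp 2 (x, y)) =
              WithLp.toLp 2
                (x - γ • prox (scale (η / γ) (conj φ)) (γ⁻¹ • x),
                  prox (scale
                    (γ * (conj φ (prox (scale (η / γ) (conj φ)) (γ⁻¹ • x))).toReal)
                    (negEnv s)) y)] : Fin 4 → Prop) i := by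
  refine ⟨existsUnique_mem_Omega hφ hφ_nonneg hs hS hγ, fun x y => ?_⟩
  obtain ⟨η, hη, h⟩ := exists_solvesMain hφ hφ_nonneg hs hS hγ x y
  have huniq : ∀ η' : ℝ, 0 ≤ η' → SolvesMain φ s γ x y η' → η' = η := fun η' hη' h' =>
    h'.unique hφ hφ_nonneg hs hS hγ hη' hη h
  have hprox := h.isProx hφ hφ_nonneg hs hS hγ hη
  refine ⟨⟨_, hprox⟩, η, ⟨hη, h⟩, huniq, ?_⟩
  have hz := hprox.prox_eq
  obtain ⟨h1, h2⟩ := (solvesMain_iff hs hS hη).1 h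
  -- Each alternative contains membership in its region, and membership implies the rest, so
  -- exclusivity is inherited from the partition.
  refine (existsUnique_congr fun i => ?_).1
    (existsUnique_mem_Omega hφ hφ_nonneg hs hS hγ (x, y))
  fin_cases i
  · refine ⟨fun hΩ => ⟨hΩ, ?_⟩, fun hΩ => hΩ.1⟩
    obtain rfl : 0 = η := huniq 0 le_rfl (solvesMain_of_mem_Omega1 hs hS hΩ)
    refine ⟨rfl, ?_⟩
    have h0 := hΩ.1
    simp only [proj_closure_dom] at h0
    rw [hz, zero_div, proxValue, h0, EReal.toReal_zero, mul_zero, proj_closure_dom,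
      proj_closure_posSet hs hS]
  · refine ⟨fun hΩ => ⟨hΩ, ?_⟩, fun hΩ => hΩ.1⟩
    obtain rfl : 0 = η := huniq 0 le_rfl (solvesMain_of_mem_Omega2 hs hS hγ hΩ)
    refine ⟨rfl, ?_⟩
    obtain ⟨h3, h4, -⟩ := hΩ
    simp only [proj_closure_dom] at h3 h4
    rw [hz, zero_div, proj_closure_dom, negEnv_eq hs hS,
      prox_scale_of_pos (mul_pos hγ (EReal.toReal_pos h3 h4.ne)), proxValue]
  · refine ⟨fun hΩ => ⟨hΩ, ?_⟩, fun hΩ => hΩ.1⟩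
    obtain ⟨hpos, hsol⟩ := solvesMain_of_mem_Omega3 hs hS hγ hΩ
    have he := huniq _ hpos.le hsol
    obtain ⟨h3, h4, h5⟩ := hΩ
    simp only at h3 h4 h5
    rw [prox_scale_of_pos (div_pos hpos hγ), he] at h3
    refine ⟨?_, he ▸ hpos, ?_⟩
    · rw [← he]; exact EReal.coe_toReal h5.ne (EReal.bot_lt_zero.trans h4).ne'
    · rw [hz, prox_scale_of_pos (div_pos hpos hγ), he, proxValue, h3, EReal.toReal_zero, mul_zero,
        proj_closure_posSet hs hS]
  · refine ⟨fun hΩ => ⟨hΩ, ?_⟩, fun hΩ => hΩ.1⟩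
    obtain ⟨hη0, hc⟩ := h.pos_of_mem_Omega4 hφ_nonneg hs hS hγ hη hΩ
    rw [prox_scale_of_pos (div_pos hη0 hγ), negEnv_eq hs hS,
      prox_scale_of_pos (mul_pos hγ (EReal.toReal_pos hc h1.ne))]
    exact ⟨hη0, hc, h1, h2.symm, hz⟩
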